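/- Graphs are finite, simple and undirected. A $\mathcal U$-bubble structure $\mathcal B$ for a finite non-empty set $V$ consists of a number of columns $\ell$, column lengths $r_1,\dots,r_\ell$, and a partition of $V$ into (possibly empty) bubbles $B_{i,j}$ ($1\le j\le \ell$, $1\le i\le r_j$), each of which is further partitioned into four (possibly empty) quadrants $B_{i,j}^{r,s}$, $r,s\in\{+,-\}$; put $B_{i,j}^{*,+}=B_{i,j}^{+,+}\cup B_{i,j}^{-,+}$ and $B_{i,j}^{+,*}=B_{i,j}^{+,+}\cup B_{i,j}^{+,-}$. In the graph $G(\mathcal B)$ with vertex set $V$, distinct vertices are adjacent if and only if they can be named $u\in B_{i,j}$ and $v\in B_{i',j'}$ so that $j=j'$, or $j=j'-1$ and $i>i'$, or $j=j'-1$, $i=i'$, $u\in B_{i,j}^{*,+}$ and $v\in B_{i',j'}^{+,*}$. The structure $\mathcal B$ is a $\mathcal U$-bubble model for a graph $G=(V,E)$ if (i) $G$ is isomorphic to $G(\mathcal B)$; (ii) each column and each row contains a non-empty bubble; (iii) no column ends with an empty bubble, i.e. $B_{r_j,j}\neq\emptyset$ for all $j$; (iv) writing $\mathrm{top}(j)=\min\{i: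 B_{i,j}\ne\emptyset\}$, we have $\mathrm{top}(1)=1$ and $\mathrm{top}(j)\le\mathrm{top}(j+1)$ for $1\le j<\ell$. Its number of rows is $\max_j r_j$. Claim: the size of a maximum cut (the maximum over all $S\subseteq V$ of the number of edges with exactly one endpoint in $S$) of a graph given by a $\mathcal U$-bubble model with $k$ rows can be computed in time $O(n^{4k+O(1)})$, where $n=|V|$. Precisely: there are a single program $P$ for a word RAM (finitely many registers, random-access memory, unit-cost addition, truncated subtraction, multiplication, integer division, loads, stores, zero tests, conditionals and while loops) and constants $c,C\in\mathbb N$ such that for all $k$ and $n$, every graph $G$ on $n\ge 1$ vertices, every $\mathcal U$-bubble model $\mathcal B$ for $G$ with exactly $k$ rows, every enumeration of the vertices, and every word length $w$ with $2^w\ge C\,n^{4k+c}$, the program $P$, started on $w$-bit words with the input consisting of $n$ and, for each vertex in turn, its row index, its column index and the two signs of its quadrant, halts after at most $C\,n^{4k+c}$ steps, without ever writing a number that does not fit into $w$ bits, and outputs the size of a maximum cut of $G$. -/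

import Mathlib

/-! ### Maximum cut -/

/-- The number of edges of `G` with one endpoint in `S` and the other one outside `S`. -/
noncomputable def cutSize {V : Type*} (G : SimpleGraph V) (S : Finset V) : ℕ :=
  Set.ncard {e : Sym2 V | e ∈ G.edgeSet ∧ ∃ u v : V, u ∈ S ∧ v ∉ S ∧ e = s(u, v)}

/-- The size of a maximum cut of the finite graph `G`. -/
noncomputable def maxCutSize {V : Type*} [Fintype V] (G : SimpleGraph V) : ℕ :=
  (Finset.univ : Finset (Finset V)).sup (cutSize G)

/-! ### `U`-bubble structures and `U`-bubble models -/

/-- A 2-dimensional `U`-bubble structure for `V`: columns `1, …, numCols`, the `j`-th one having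
the bubbles `B_{1,j}, …, B_{len j, j}`, every bubble being split into four quadrants.
The partition of `V` is given by the place of each vertex: `v ∈ B_{i,j}^{r,s}` iff
`row v = i`, `col v = j`, `leftClosed v` iff `r = +`, and `rightClosed v` iff `s = +`.
Only the values of `len` on `1, …, numCols` matter. -/
structure UBubbleStructure (V : Type*) where
  /-- the number of columns -/
  numCols : ℕ
  /-- the length of the `j`-th column, `1 ≤ j ≤ numCols` -/
  len : ℕ → ℕ
  /-- the column-index of a vertex -/
  col : V → ℕ
  /-- the row-index of a vertex -/
  row : V → ℕ
  /-- first component of the type of the quadrant of a vertex, `true` for `+` -/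
  leftClosed : V → Bool
  /-- second component of the type of the quadrant of a vertex, `true` for `+` -/
  rightClosed : V → Bool
  one_le_col : ∀ v, 1 ≤ col v
  col_le : ∀ v, col v ≤ numCols
  one_le_row : ∀ v, 1 ≤ row v
  row_le : ∀ v, row v ≤ len (col v)

namespace UBubbleStructure

variable {V : Type*}

/-- The bubble `B_{i,j}`. -/
def bubble (B : UBubbleStructure V) (i j : ℕ) : Set V :=
  {v | B.row v = i ∧ B.col v = j}

/-- The quadrant `B_{i,j}^{r,s}`, with `true` for `+` and `false` for `-`. -/
def quadrant (B : UBubbleStructure V) (i j : ℕ) (r s : Bool) : Set V :=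
  {v | v ∈ B.bubble i j ∧ B.leftClosed v = r ∧ B.rightClosed v = s}

/-- The number of rows: the length of a longest column. -/
def numRows (B : UBubbleStructure V) : ℕ :=
  (Finset.Icc 1 B.numCols).sup B.len

/-- The index of the first row with a non-empty bubble in column `j`
(a genuine minimum whenever column `j` has a non-empty bubble). -/
noncomputable def topRow (B : UBubbleStructure V) (j : ℕ) : ℕ :=
  sInf {i | (B.bubble i j).Nonempty}

/-- The conditions on `u ∈ B_{i,j}` and `v ∈ B_{i',j'}` under which `uv` is an edge of the graph
given by `B`: `j = j'`, or `j = j' - 1` and `i > i'`, or `j = j' - 1` and `i = i'` and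
`u ∈ B_{i,j}^{*,+}` and `v ∈ B_{i',j'}^{+,*}`. -/
def Linked (B : UBubbleStructure V) (u v : V) : Prop :=
  ∃ i i' j j' : ℕ, u ∈ B.bubble i j ∧ v ∈ B.bubble i' j' ∧
    (j = j' ∨
      (j + 1 = j' ∧ i' < i) ∨
      (j + 1 = j' ∧ i = i' ∧
        (∃ r, u ∈ B.quadrant i j r true) ∧ (∃ s, v ∈ B.quadrant i' j' true s)))

/-- The graph `G(B)` given by the `U`-bubble structure `B`. -/
def graph (B : UBubbleStructure V) : SimpleGraph V where
  Adj u v := u ≠ v ∧ (B.Linked u v ∨ B.Linked v u)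
  symm := ⟨fun _ _ h => ⟨h.1.symm, h.2.symm⟩⟩
  loopless := ⟨fun _ h => h.1 rfl⟩

/-- `B` is a `U`-bubble model for the graph `G`. -/
structure IsModel (B : UBubbleStructure V) (G : SimpleGraph V) : Prop where
  /-- `G` is isomorphic to `G(B)` -/
  iso : Nonempty (G ≃g B.graph)
  /-- each column contains a non-empty bubble -/
  col_nonempty : ∀ j, 1 ≤ j → j ≤ B.numCols → ∃ i, (B.bubble i j).Nonempty
  /-- each row contains a non-empty bubble -/
  row_nonempty : ∀ i, 1 ≤ i → i ≤ B.numRows → ∃ j, (B.bubble i j).Nonempty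
  /-- no column ends with an empty bubble -/
  last_nonempty : ∀ j, 1 ≤ j → j ≤ B.numCols → (B.bubble (B.len j) j).Nonempty
  topRow_one : B.topRow 1 = 1
  topRow_mono : ∀ j, 1 ≤ j → j < B.numCols → B.topRow j ≤ B.topRow (j + 1)

end UBubbleStructure

/-! ### A word RAM with unit cost -/

namespace WordRAM

/-- The arithmetic operations of the machine. -/
inductive Op where
  | add | sub | mul | div

/-- The result of an operation; subtraction is truncated at `0`. -/
def Op.eval : Op → ℕ → ℕ → ℕ
  | .add, a, b => a + b
  | .sub, a, b => a - b
  | .mul, a, b => a * b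
  | .div, a, b => a / b

/-- Programs. The numbers `d`, `x`, `y` are names of registers. -/
inductive Prog where
  /-- do nothing -/
  | skip
  /-- `R_d := a` -/
  | const (d a : ℕ)
  /-- `R_d := R_x o R_y` -/
  | op (o : Op) (d x y : ℕ)
  /-- `R_d := M[R_x]` -/
  | load (d x : ℕ)
  /-- `M[R_x] := R_y` -/
  | store (x y : ℕ)
  /-- first `p`, then `q` -/
  | seq (p q : Prog)
  /-- if `R_x ≠ 0` then `p` else `q` -/
  | cond (x : ℕ) (p q : Prog)
  /-- while `R_x ≠ 0` do `p` -/
  | loop (x : ℕ) (p : Prog)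

/-- A state of the machine: the contents of the registers and of the memory cells. -/
structure State where
  reg : ℕ → ℕ
  mem : ℕ → ℕ

/-- `Runs w p s t s'`: on a machine with `w`-bit words, `p` started in the state `s` halts in the
state `s'` after exactly `t` steps. Every assignment and every test takes one step. Only numbers
below `2 ^ w` can be written to a register or to a memory cell: a program that attempts to write a
larger number gets stuck and does not halt. -/
inductive Runs (w : ℕ) : Prog → State → ℕ → State → Prop where
  | skip (s : State) : Runs w .skip s 1 s
  | const (s : State) (d a : ℕ) (h : a < 2 ^ w) :
      Runs w (.const d a) s 1 ⟨Function.update s.reg d a, s.mem⟩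
  | op (s : State) (o : Op) (d x y : ℕ) (h : o.eval (s.reg x) (s.reg y) < 2 ^ w) :
      Runs w (.op o d x y) s 1 ⟨Function.update s.reg d (o.eval (s.reg x) (s.reg y)), s.mem⟩
  | load (s : State) (d x : ℕ) (h : s.mem (s.reg x) < 2 ^ w) :
      Runs w (.load d x) s 1 ⟨Function.update s.reg d (s.mem (s.reg x)), s.mem⟩
  | store (s : State) (x y : ℕ) (h : s.reg y < 2 ^ w) :
      Runs w (.store x y) s 1 ⟨s.reg, Function.update s.mem (s.reg x) (s.reg y)⟩
  | seq {p q : Prog} {s₁ s₂ s₃ : State} {t₁ t₂ : ℕ}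
      (hp : Runs w p s₁ t₁ s₂) (hq : Runs w q s₂ t₂ s₃) : Runs w (.seq p q) s₁ (t₁ + t₂) s₃
  | condTrue {x : ℕ} {p q : Prog} {s s' : State} {t : ℕ}
      (hx : s.reg x ≠ 0) (hp : Runs w p s t s') : Runs w (.cond x p q) s (t + 1) s'
  | condFalse {x : ℕ} {p q : Prog} {s s' : State} {t : ℕ}
      (hx : s.reg x = 0) (hq : Runs w q s t s') : Runs w (.cond x p q) s (t + 1) s'
  | loopDone {x : ℕ} {p : Prog} {s : State}
      (hx : s.reg x = 0) : Runs w (.loop x p) s 1 s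
  | loopStep {x : ℕ} {p : Prog} {s₁ s₂ s₃ : State} {t₁ t₂ : ℕ}
      (hx : s₁.reg x ≠ 0) (hp : Runs w p s₁ t₁ s₂) (hl : Runs w (.loop x p) s₂ t₂ s₃) :
      Runs w (.loop x p) s₁ (t₁ + t₂ + 1) s₃

/-- The initial state with the given memory contents: all registers are `0`. -/
def initState (m : ℕ → ℕ) : State := ⟨fun _ => 0, m⟩

end WordRAM

/-- The memory contents encoding a `U`-bubble structure on `n` vertices, listed in the order `e`:
cell `0` holds `n`, and the cells `4 t + 1, …, 4 t + 4` hold the row-index, the column-index and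
the two components of the quadrant type (`1` for `+`, `0` for `-`) of the `t`-th vertex, `t < n`;
all other cells hold `0`. -/
def UBubbleStructure.encode {V : Type*} {n : ℕ} (B : UBubbleStructure V) (e : Fin n ≃ V)
    (a : ℕ) : ℕ :=
  if a = 0 then n
  else if h : (a - 1) / 4 < n then
    match (a - 1) % 4 with
    | 0 => B.row (e ⟨(a - 1) / 4, h⟩)
    | 1 => B.col (e ⟨(a - 1) / 4, h⟩)
    | 2 => (B.leftClosed (e ⟨(a - 1) / 4, h⟩)).toNat
    | _ => (B.rightClosed (e ⟨(a - 1) / 4, h⟩)).toNat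
  else 0

/-! The graph of a `U`-bubble structure has edges inside a column and between consecutive columns
only, and a vertex `v` of column `j` is adjacent to a vertex `u` of column `j - 1` iff
`threshold v ≤ key u`, where `key` and `threshold` encode row and sign in one number
(`UBubbleStructure.linked_iff`). So when the vertices are inserted column by column, all that matters
of a partial solution `S` are, for every `t < 2 * k`, the numbers of vertices of `S` with key at
least `t` in the current and in the preceding column. These are `4 * k` numbers between `0` and
`n`; written as the digits of one number in base `n + 1` they form the code of `S`
(`UBubbleStructure.code`). A new vertex of the current column finds the number of its chosen
neighbours in two digits of the code (`UBubbleStructure.nbrCount_eq`), and choosing it adds a fixed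
weight to the code.

This gives a dynamic program over tables that are indexed by the codes and hold one more than the
size of a largest cut with this code, `0` marking the numbers that are not codes
(`UBubbleStructure.IsTable`). Both inserting a vertex and passing to the next column are instances
of one kind of `Transition`, pushing every nonzero entry of a table to two places of the next table
(`IsTable.pushes_vertex`, `IsTable.pushes_shift`); every transition writes to fresh memory, which is
still `0`. After `n + 1` columns the two columns recorded by the codes are empty, and the only entry
left, at `0`, gives the maximum cut (`IsTable.eq_maxCutSize`).

There are at most `2 * n + 1` transitions, each of them taking time proportional to the number
`(n + 1) ^ (4 * k)` of codes, which is at most `81 * n ^ (4 * k)` because `k ≤ n`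
(`numCodes_le`). The program is verified by a calculus for total correctness with time bounds
(`WordRAM.Achieves`) in which loop-free code is reduced to a verification condition
(`WordRAM.VC`), and loops are handled by invariants indexed by a register counting down. -/

/-! ### Verification of word RAM programs -/

namespace WordRAM

/-- The state whose first registers hold the entries of `l`, all other registers being `0`. -/
def listState (l : List ℕ) (m : ℕ → ℕ) : State := ⟨fun i => l.getD i 0, m⟩

/-- Total correctness with a time bound: `p`, started with register list `l` and memory `m`, halts
within `T` steps with a register list and a memory satisfying `Q`. -/
def Achieves (w : ℕ) (p : Prog) (T : ℕ) (l : List ℕ) (m : ℕ → ℕ)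
    (Q : List ℕ → (ℕ → ℕ) → Prop) : Prop :=
  ∃ t l' m', Runs w p (listState l m) t (listState l' m') ∧ t ≤ T ∧ Q l' m'

variable {w : ℕ}

theorem Achieves.mono {p : Prog} {T T' : ℕ} {l : List ℕ} {m : ℕ → ℕ}
    {Q Q' : List ℕ → (ℕ → ℕ) → Prop} (h : Achieves w p T l m Q) (hT : T ≤ T')
    (hQ : ∀ l m, Q l m → Q' l m) : Achieves w p T' l m Q' := by
  obtain ⟨t, l', m', hr, ht, hq⟩ := h
  exact ⟨t, l', m', hr, ht.trans hT, hQ _ _ hq⟩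

theorem Achieves.seq {p q : Prog} {T₁ T₂ : ℕ} {l : List ℕ} {m : ℕ → ℕ}
    {Q R : List ℕ → (ℕ → ℕ) → Prop} (hp : Achieves w p T₁ l m R)
    (hq : ∀ l' m', R l' m' → Achieves w q T₂ l' m' Q) :
    Achieves w (.seq p q) (T₁ + T₂) l m Q := by
  obtain ⟨t₁, l₁, m₁, hr₁, ht₁, h₁⟩ := hp
  obtain ⟨t₂, l₂, m₂, hr₂, ht₂, h₂⟩ := hq l₁ m₁ h₁
  exact ⟨_, l₂, m₂, .seq hr₁ hr₂, by omega, h₂⟩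

theorem Achieves.cond {x : ℕ} {p q : Prog} {T : ℕ} {l : List ℕ} {m : ℕ → ℕ}
    {Q : List ℕ → (ℕ → ℕ) → Prop} (hp : l.getD x 0 ≠ 0 → Achieves w p T l m Q)
    (hq : l.getD x 0 = 0 → Achieves w q T l m Q) :
    Achieves w (.cond x p q) (T + 1) l m Q := by
  by_cases hx : l.getD x 0 = 0
  · obtain ⟨t, l', m', hr, ht, h⟩ := hq hx
    exact ⟨_, l', m', .condFalse hx hr, by omega, h⟩
  · obtain ⟨t, l', m', hr, ht, h⟩ := hp hx
    exact ⟨_, l', m', .condTrue hx hr, by omega, h⟩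

/-- The rule for a loop whose control register counts down to `0`; `I i` is the invariant at the
times when this register holds `i`. -/
theorem Achieves.loop {x : ℕ} {p : Prog} {T : ℕ} (I : ℕ → List ℕ → (ℕ → ℕ) → Prop)
    (hx : ∀ i l m, I i l m → l.getD x 0 = i)
    (hstep : ∀ i l m, I (i + 1) l m → Achieves w p T l m (I i)) :
    ∀ (i : ℕ) (l : List ℕ) (m : ℕ → ℕ), I i l m →
      Achieves w (.loop x p) (i * (T + 1) + 1) l m (I 0)
  | 0, l, m, h => ⟨1, l, m, .loopDone (hx 0 l m h), by omega, h⟩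
  | i + 1, l, m, h => by
    obtain ⟨t₁, l₁, m₁, hr₁, ht₁, h₁⟩ := hstep i l m h
    obtain ⟨t₂, l₂, m₂, hr₂, ht₂, h₂⟩ := Achieves.loop I hx hstep i l₁ m₁ h₁
    refine ⟨_, l₂, m₂, .loopStep ?_ hr₁ hr₂, ?_, h₂⟩
    · change l.getD x 0 ≠ 0
      rw [hx _ _ _ h]
      omega
    · rw [Nat.succ_mul]
      omega

/-- The verification condition of a loop-free program for the postcondition `Q`: all writes go to
listed registers and fit into `w` bits, and `Q` holds in the end. -/
def VC (w : ℕ) : Prog → (List ℕ → (ℕ → ℕ) → Prop) → List ℕ → (ℕ → ℕ) → Prop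
  | .skip, Q, l, m => Q l m
  | .const d a, Q, l, m => d < l.length ∧ a < 2 ^ w ∧ Q (l.set d a) m
  | .op o d x y, Q, l, m => d < l.length ∧ o.eval (l.getD x 0) (l.getD y 0) < 2 ^ w ∧
      Q (l.set d (o.eval (l.getD x 0) (l.getD y 0))) m
  | .load d x, Q, l, m => d < l.length ∧ m (l.getD x 0) < 2 ^ w ∧ Q (l.set d (m (l.getD x 0))) m
  | .store x y, Q, l, m => l.getD y 0 < 2 ^ w ∧ Q l (Function.update m (l.getD x 0) (l.getD y 0))
  | .seq p q, Q, l, m => VC w p (VC w q Q) l m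
  | .cond x p q, Q, l, m =>
      (l.getD x 0 ≠ 0 → VC w p Q l m) ∧ (l.getD x 0 = 0 → VC w q Q l m)
  | .loop _ _, _, _, _ => False

/-- An upper bound for the running time of a loop-free program. -/
def Prog.cost : Prog → ℕ
  | .seq p q => p.cost + q.cost
  | .cond _ p q => p.cost + q.cost + 1
  | _ => 1

theorem update_getD (l : List ℕ) {d : ℕ} (hd : d < l.length) (a : ℕ) :
    Function.update (fun i => l.getD i 0) d a = fun i => (l.set d a).getD i 0 := by
  funext i
  by_cases h : i = d
  · subst h
    simp [List.getD, hd]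
  · rw [Function.update_of_ne h]
    simp [List.getD, List.getElem?_set_ne (Ne.symm h)]

/-- Soundness of verification conditions. -/
theorem Achieves.of_vc {p : Prog} {Q : List ℕ → (ℕ → ℕ) → Prop} {l : List ℕ} {m : ℕ → ℕ}
    (h : VC w p Q l m) : Achieves w p p.cost l m Q := by
  induction p generalizing Q l m with
  | skip => exact ⟨1, l, m, .skip _, le_rfl, h⟩
  | const d a =>
    refine ⟨1, _, m, ?_, le_rfl, h.2.2⟩
    have := Runs.const (listState l m) d a h.2.1
    rwa [listState, update_getD l h.1] at this
  | op o d x y =>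
    refine ⟨1, _, m, ?_, le_rfl, h.2.2⟩
    have := Runs.op (listState l m) o d x y h.2.1
    rwa [listState, update_getD l h.1] at this
  | load d x =>
    refine ⟨1, _, m, ?_, le_rfl, h.2.2⟩
    have := Runs.load (listState l m) d x h.2.1
    rwa [listState, update_getD l h.1] at this
  | store x y => exact ⟨1, l, _, Runs.store (listState l m) x y h.1, le_rfl, h.2⟩
  | seq p q hp hq => exact (hp h).seq fun l' m' h' => hq h'
  | cond x p q hp hq =>
    exact (Achieves.cond (fun hx => (hp (h.1 hx)).mono (Nat.le_add_right _ _) fun _ _ => id)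
      fun hx => (hq (h.2 hx)).mono (Nat.le_add_left _ _) fun _ _ => id)
  | loop x p => exact h.elim

/-- The sequential composition of a list of programs. -/
def block : List Prog → Prog
  | [] => .skip
  | p :: ps => .seq p (block ps)

/-- `R_d := R_d * R_b ^ R_x`, with `R_o` holding `1`; the register `R_x` is counted down to `0`. -/
def powLoop (d b x o : ℕ) : Prog :=
  .loop x (block [.op .mul d d b, .op .sub x x o])

/-- The result as an exact list of registers. The intermediate powers fit into `w` bits as soon as
the last one does, since `R_b` is not `0`. -/
theorem powLoop_achieves {d b x o : ℕ} {l : List ℕ} (m : ℕ → ℕ) (hd : d < l.length)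
    (hxl : x < l.length) (ho : l.getD o 0 = 1) (hb : 1 ≤ l.getD b 0)
    (hdb : d ≠ b) (hdx : d ≠ x) (hdo : d ≠ o) (hxb : x ≠ b) (hxo : x ≠ o)
    (hw : l.getD d 0 * l.getD b 0 ^ l.getD x 0 < 2 ^ w) (hxw : l.getD x 0 < 2 ^ w) :
    Achieves w (powLoop d b x o) (l.getD x 0 * 4 + 1) l m
      (fun l' m' => l' = (l.set d (l.getD d 0 * l.getD b 0 ^ l.getD x 0)).set x 0 ∧ m' = m) := by
  set D := l.getD d 0 with hD
  set A := l.getD b 0 with hA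
  set e := l.getD x 0 with he
  have key := Achieves.loop (w := w) (x := x) (p := block [.op .mul d d b, .op .sub x x o])
    (T := 3)
    (fun i l' m' => i ≤ e ∧ l' = (l.set d (D * A ^ (e - i))).set x i ∧ m' = m)
    (by
      rintro i l' m' ⟨-, rfl, -⟩
      simp [List.getD, hxl])
    (by
      rintro i l' m' ⟨hi, rfl, rfl⟩
      have e1 : ((l.set d (D * A ^ (e - (i + 1)))).set x (i + 1)).getD d 0
          = D * A ^ (e - (i + 1)) := by
        rw [List.getD, List.getElem?_set_ne (Ne.symm hdx)]
        simp [hd]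
      have e2 : ∀ (y z : ℕ), ((l.set d y).set x z).getD b 0 = A := by
        intro y z
        rw [hA]
        simp [List.getD, List.getElem?_set_ne hdb, List.getElem?_set_ne hxb]
      have e3 : ∀ (y z : ℕ), ((l.set d y).set x z).getD o 0 = 1 := by
        intro y z
        rw [← ho]
        simp [List.getD, List.getElem?_set_ne hdo, List.getElem?_set_ne hxo]
      have e4 : ∀ (y z : ℕ), ((l.set d y).set x z).getD x 0 = z := by
        intro y z
        simp [List.getD, hxl]
      have hpow : D * A ^ (e - (i + 1)) * A = D * A ^ (e - i) := by
        rw [mul_assoc, ← pow_succ]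
        congr 2
        omega
      have hs : (((l.set d (D * A ^ (e - (i + 1)))).set x (i + 1)).set d
          (D * A ^ (e - i))) = (l.set d (D * A ^ (e - i))).set x (i + 1) := by
        rw [List.set_comm _ _ hdx.symm, List.set_set]
      have hle : D * A ^ (e - i) ≤ D * A ^ e :=
        Nat.mul_le_mul_left _ (Nat.pow_le_pow_right hb (Nat.sub_le _ _))
      refine (Achieves.of_vc (p := block [.op .mul d d b, .op .sub x x o]) ?_)
      simp only [block, VC, Op.eval, e1, e2, hpow, hs, e3, e4, List.length_set]
      refine ⟨hd, lt_of_le_of_lt hle hw, hxl, by omega, by omega, ?_, trivial⟩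
      rw [List.set_set]
      congr 1)
    e l m
    ⟨le_rfl, by
      rw [Nat.sub_self, pow_zero, mul_one, hD, he]
      apply List.ext_getElem?
      intro i
      simp only [List.getElem?_set]
      split_ifs <;> simp_all [List.getD], rfl⟩
  refine key.mono (by omega) ?_
  rintro l' m' ⟨-, h, h'⟩
  exact ⟨by simpa using h, h'⟩

end WordRAM

/-! ### Cuts and vertex insertion -/

section Cut

open Classical in
/-- The number of neighbours of `v` in `S`. -/
noncomputable def nbrCount {V : Type*} (G : SimpleGraph V) (S : Finset V) (v : V) : ℕ :=
  (S.filter fun u => G.Adj u v).card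

open Classical in
/-- The number of edges between `S` and `U \ S`. -/
noncomputable def cutWithin {V : Type*} (G : SimpleGraph V) (S U : Finset V) : ℕ :=
  ∑ u ∈ S, nbrCount G (U \ S) u

variable {V : Type*} {G : SimpleGraph V}

open Classical in
theorem cutWithin_insert_right {S U : Finset V} {v : V} (hv : v ∉ U) (hS : S ⊆ U) :
    cutWithin G S (insert v U) = cutWithin G S U + nbrCount G S v := by
  have hvS : v ∉ S := fun h => hv (hS h)
  have h1 : insert v U \ S = insert v (U \ S) := Finset.insert_sdiff_of_notMem _ hvS
  unfold cutWithin nbrCount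
  rw [h1, Finset.card_filter, ← Finset.sum_add_distrib]
  refine Finset.sum_congr rfl fun u _ => ?_
  rw [Finset.filter_insert]
  by_cases h : G.Adj v u
  · rw [if_pos h, if_pos h.symm, Finset.card_insert_of_notMem]
    simp [hv]
  · rw [if_neg h, if_neg fun h' => h h'.symm, add_zero]

open Classical in
theorem cutWithin_insert_insert {S U : Finset V} {v : V} (hv : v ∉ U) (hS : S ⊆ U) :
    cutWithin G (insert v S) (insert v U)
      = cutWithin G S U + (nbrCount G U v - nbrCount G S v) := by
  have hvS : v ∉ S := fun h => hv (hS h)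
  have h1 : insert v U \ insert v S = U \ S := by
    ext x
    simp only [Finset.mem_sdiff, Finset.mem_insert, not_or]
    constructor
    · rintro ⟨h | h, h', h''⟩
      · exact absurd h h'
      · exact ⟨h, h''⟩
    · rintro ⟨h, h'⟩
      exact ⟨Or.inr h, fun e => hv (e ▸ h), h'⟩
  have h2 : nbrCount G U v = nbrCount G (U \ S) v + nbrCount G S v := by
    unfold nbrCount
    rw [← Finset.card_union_of_disjoint (Finset.disjoint_filter_filter Finset.sdiff_disjoint),
      ← Finset.filter_union, Finset.sdiff_union_of_subset hS]
  unfold cutWithin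
  rw [Finset.sum_insert hvS, h1]
  omega

theorem nbrCount_le_card (S : Finset V) (v : V) : nbrCount G S v ≤ S.card := by
  classical
  exact Finset.card_filter_le _ _

theorem cutWithin_le [Fintype V] (S U : Finset V) :
    cutWithin G S U ≤ Fintype.card V * Fintype.card V := by
  classical
  unfold cutWithin
  calc _ ≤ ∑ u ∈ S, Fintype.card V :=
        Finset.sum_le_sum fun u _ => (nbrCount_le_card _ _).trans (Finset.card_le_univ _)
    _ ≤ _ := by
        rw [Finset.sum_const, smul_eq_mul]
        exact Nat.mul_le_mul_right _ (Finset.card_le_univ _)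

theorem cutWithin_univ [Fintype V] (S : Finset V) : cutWithin G S Finset.univ = cutSize G S := by
  classical
  have h1 : cutWithin G S Finset.univ =
      ((S ×ˢ (Finset.univ \ S)).filter fun p => G.Adj p.2 p.1).card := by
    unfold cutWithin nbrCount
    simp only [Finset.card_filter, Finset.sum_product]
  have h2 : {e : Sym2 V | e ∈ G.edgeSet ∧ ∃ u v : V, u ∈ S ∧ v ∉ S ∧ e = s(u, v)} =
      (((S ×ˢ (Finset.univ \ S)).filter fun p => G.Adj p.2 p.1).image
        (fun p => s(p.1, p.2)) : Finset (Sym2 V)) := by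
    ext e
    simp only [Set.mem_ofPred_eq, Finset.coe_image, Set.mem_image, Finset.mem_coe,
      Finset.mem_filter, Finset.mem_product, Finset.mem_sdiff, Finset.mem_univ, true_and,
      Prod.exists]
    constructor
    · rintro ⟨he, u, v, hu, hv, rfl⟩
      exact ⟨u, v, ⟨⟨hu, hv⟩, ((SimpleGraph.mem_edgeSet G).1 he).symm⟩, rfl⟩
    · rintro ⟨u, v, ⟨⟨hu, hv⟩, ha⟩, rfl⟩
      exact ⟨(SimpleGraph.mem_edgeSet G).2 ha.symm, u, v, hu, hv, rfl⟩
  rw [cutSize, h2, Set.ncard_coe_finset, h1, Finset.card_image_of_injOn]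
  rintro ⟨a, b⟩ hp ⟨c, d⟩ hq h
  simp only [Finset.coe_filter, Finset.mem_product, Finset.mem_sdiff, Finset.mem_univ, true_and,
    Set.mem_ofPred_eq] at hp hq
  rcases Sym2.eq_iff.1 h with ⟨h1, h2⟩ | ⟨h1, h2⟩
  · exact Prod.ext h1 h2
  · simp only at h1
    exact absurd (h1 ▸ hp.1.1) hq.1.2

theorem maxCutSize_le_of_iso [Fintype V] {H : SimpleGraph V} (φ : G ≃g H) :
    maxCutSize G ≤ maxCutSize H := by
  classical
  refine Finset.sup_le fun S _ => ?_
  refine le_trans (le_of_eq ?_)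
    (Finset.le_sup (f := cutSize H) (Finset.mem_univ (S.map φ.toEquiv.toEmbedding)))
  unfold cutSize
  have : {e : Sym2 V | e ∈ H.edgeSet ∧ ∃ u v : V, u ∈ S.map φ.toEquiv.toEmbedding ∧
        v ∉ S.map φ.toEquiv.toEmbedding ∧ e = s(u, v)} =
      Sym2.map φ '' {e : Sym2 V | e ∈ G.edgeSet ∧ ∃ u v : V, u ∈ S ∧ v ∉ S ∧ e = s(u, v)} := by
    ext e
    constructor
    · rintro ⟨he, u, v, hu, hv, rfl⟩
      obtain ⟨a, ha, rfl⟩ := Finset.mem_map.1 hu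
      obtain ⟨b, rfl⟩ := φ.surjective v
      refine ⟨s(a, b), ⟨?_, a, b, ha, fun hb => hv (Finset.mem_map_of_mem _ hb), rfl⟩, rfl⟩
      rw [SimpleGraph.mem_edgeSet] at he ⊢
      exact φ.map_adj_iff.1 he
    · rintro ⟨_, ⟨he, u, v, hu, hv, rfl⟩, rfl⟩
      rw [SimpleGraph.mem_edgeSet] at he
      refine ⟨?_, φ u, φ v, Finset.mem_map_of_mem _ hu, fun hb => ?_, rfl⟩
      · rw [Sym2.map_mk, SimpleGraph.mem_edgeSet]
        exact φ.map_adj_iff.2 he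
      · obtain ⟨a, ha, h⟩ := Finset.mem_map.1 hb
        exact hv (φ.injective h ▸ ha)
  rw [this, Set.ncard_image_of_injective _ (Sym2.map.injective φ.injective)]

theorem maxCutSize_eq_of_iso [Fintype V] {H : SimpleGraph V} (φ : G ≃g H) :
    maxCutSize G = maxCutSize H :=
  le_antisymm (maxCutSize_le_of_iso φ) (maxCutSize_le_of_iso φ.symm)

end Cut

/-! ### Positional codes of partial solutions -/

section Digits

theorem sum_digits_lt {N : ℕ} {c : ℕ → ℕ} (hc : ∀ t, c t < N) (m : ℕ) :
    ∑ t ∈ Finset.range m, N ^ t * c t < N ^ m := by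
  induction m with
  | zero => simp
  | succ m ih =>
    rw [Finset.sum_range_succ, pow_succ]
    have : N ^ m * c m + N ^ m ≤ N ^ m * N := by
      rw [← Nat.mul_succ]
      exact Nat.mul_le_mul_left _ (hc m)
    omega

theorem sum_digits_div_mod {N : ℕ} {c : ℕ → ℕ} (hc : ∀ t, c t < N) (m i : ℕ) :
    (∑ t ∈ Finset.range m, N ^ t * c t) / N ^ i % N = if i < m then c i else 0 := by
  induction m generalizing c i with
  | zero => simp
  | succ m ih =>
    have h : ∑ t ∈ Finset.range (m + 1), N ^ t * c t =
        c 0 + N * ∑ t ∈ Finset.range m, N ^ t * c (t + 1) := by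
      rw [Finset.sum_range_succ', Finset.mul_sum, pow_zero, one_mul, add_comm]
      congr 1
      exact Finset.sum_congr rfl fun t _ => by ring
    have hN : 0 < N := lt_of_le_of_lt (Nat.zero_le _) (hc 0)
    cases i with
    | zero => simp [h, Nat.add_mul_mod_self_left, Nat.mod_eq_of_lt (hc 0)]
    | succ i =>
      rw [h, pow_succ', ← Nat.div_div_eq_div_mul, Nat.add_mul_div_left _ _ hN,
        Nat.div_eq_of_lt (hc 0), zero_add, ih (c := fun t => c (t + 1)) fun t => hc (t + 1)]
      simp

end Digits

namespace UBubbleStructure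

variable {V : Type*} (B : UBubbleStructure V)

/-- The rank of a vertex among the vertices of its column: by row, and inside a row the vertices
with right sign `+` come last. -/
def key (v : V) : ℕ := 2 * (B.row v - 1) + (B.rightClosed v).toNat

/-- The least key that a vertex of the preceding column adjacent to `v` can have. -/
def threshold (v : V) : ℕ := 2 * B.row v - (B.leftClosed v).toNat

theorem key_lt {K : ℕ} {v : V} (h : B.row v ≤ K) : B.key v < 2 * K := by
  have := B.one_le_row v
  have := Bool.toNat_le (B.rightClosed v)
  unfold key
  omega

/-- The edges between consecutive columns are given by comparing one number of each endpoint. -/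
theorem linked_iff (u v : V) : B.Linked u v ↔
    B.col u = B.col v ∨ B.col u + 1 = B.col v ∧ B.threshold v ≤ B.key u := by
  have hu := B.one_le_row u
  have hv := B.one_le_row v
  have h1 : B.Linked u v ↔ B.col u = B.col v ∨ (B.col u + 1 = B.col v ∧ B.row v < B.row u) ∨
      (B.col u + 1 = B.col v ∧ B.row u = B.row v ∧ B.rightClosed u = true ∧
        B.leftClosed v = true) := by
    unfold Linked bubble quadrant bubble
    constructor
    · rintro ⟨i, i', j, j', ⟨rfl, rfl⟩, ⟨rfl, rfl⟩, h⟩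
      rcases h with h | h | ⟨h, h', ⟨r, hr⟩, ⟨s, hs⟩⟩
      · exact Or.inl h
      · exact Or.inr (Or.inl h)
      · exact Or.inr (Or.inr ⟨h, h', hr.2.2, hs.2.1⟩)
    · rintro h
      refine ⟨_, _, _, _, ⟨rfl, rfl⟩, ⟨rfl, rfl⟩, ?_⟩
      rcases h with h | h | ⟨h, h', hr, hs⟩
      · exact Or.inl h
      · exact Or.inr (Or.inl h)
      · exact Or.inr (Or.inr ⟨h, h', ⟨_, ⟨rfl, rfl⟩, rfl, hr⟩, ⟨_, ⟨rfl, rfl⟩, hs, rfl⟩⟩)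
  rw [h1]
  unfold threshold key
  cases B.rightClosed u <;> cases B.leftClosed v <;> simp <;> omega

theorem adj_iff_of_col_le {u v : V} (huv : u ≠ v) (h : B.col u ≤ B.col v) : B.graph.Adj u v ↔
    B.col u = B.col v ∨ B.col u + 1 = B.col v ∧ B.threshold v ≤ B.key u := by
  change u ≠ v ∧ (B.Linked u v ∨ B.Linked v u) ↔ _
  rw [linked_iff, linked_iff]
  constructor
  · rintro ⟨-, h' | h'⟩
    · exact h'
    · omega
  · exact fun h' => ⟨huv, Or.inl h'⟩

/-- The contribution of one vertex to the code of its column: the digits `0, …, key v` are `1`. -/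
def weight (N : ℕ) (v : V) : ℕ := ∑ t ∈ Finset.range (B.key v + 1), N ^ t

/-- The code of `S` in column `j`: its `t`-th digit in base `N` is the number of vertices of `S`
in column `j` whose key is at least `t`. -/
def colCode (N j : ℕ) (S : Finset V) : ℕ := ∑ v ∈ S with B.col v = j, B.weight N v

/-- The code of `S` in the columns `j` and `j - 1`, with `2 * K` digits for each of them. -/
def code (N K j : ℕ) (S : Finset V) : ℕ :=
  B.colCode N j S + N ^ (2 * K) * B.colCode N (j - 1) S

variable {B} {N K j : ℕ}

theorem colCode_eq_sum_digits (hK : ∀ v, B.row v ≤ K) (S : Finset V) :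
    B.colCode N j S = ∑ t ∈ Finset.range (2 * K),
      N ^ t * (S.filter fun v => B.col v = j ∧ t ≤ B.key v).card := by
  unfold colCode weight
  have h : ∀ v, ∑ t ∈ Finset.range (B.key v + 1), N ^ t =
      ∑ t ∈ Finset.range (2 * K), if t ≤ B.key v then N ^ t else 0 := by
    intro v
    rw [← Finset.sum_filter]
    refine Finset.sum_congr ?_ fun _ _ => rfl
    ext t
    have := B.key_lt (hK v)
    simp only [Finset.mem_range, Finset.mem_filter]
    omega
  simp only [h]
  rw [Finset.sum_comm]
  refine Finset.sum_congr rfl fun t _ => ?_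
  rw [← Finset.sum_filter, Finset.filter_filter, Finset.sum_const, smul_eq_mul, mul_comm]

theorem colCode_lt (hK : ∀ v, B.row v ≤ K) {S : Finset V} (hS : S.card < N) :
    B.colCode N j S < N ^ (2 * K) := by
  rw [colCode_eq_sum_digits hK]
  exact sum_digits_lt (fun t => (Finset.card_filter_le _ _).trans_lt hS) _

theorem colCode_digit (hK : ∀ v, B.row v ≤ K) {S : Finset V} (hS : S.card < N) (t : ℕ) :
    B.colCode N j S / N ^ t % N = (S.filter fun v => B.col v = j ∧ t ≤ B.key v).card := by
  rw [colCode_eq_sum_digits hK,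
    sum_digits_div_mod (fun t => (Finset.card_filter_le _ _).trans_lt hS)]
  split_ifs with h
  · rfl
  · symm
    rw [Finset.card_eq_zero, Finset.filter_eq_empty_iff]
    rintro v - ⟨-, hv⟩
    have := B.key_lt (hK v)
    omega

theorem code_lt (hK : ∀ v, B.row v ≤ K) {S : Finset V} (hS : S.card < N) :
    B.code N K j S < N ^ (2 * K) * N ^ (2 * K) := by
  have h1 := colCode_lt (j := j) hK hS
  have h2 := Nat.mul_le_mul_left (N ^ (2 * K)) (colCode_lt (j := j - 1) hK hS)
  rw [Nat.mul_succ] at h2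
  unfold code
  omega

theorem code_insert [DecidableEq V] {S : Finset V} {v : V} (hv : v ∉ S) (hj : B.col v = j) :
    B.code N K j (insert v S) = B.code N K j S + B.weight N v := by
  have h1 := B.one_le_col v
  unfold code colCode
  rw [Finset.filter_insert, Finset.filter_insert, if_pos hj, if_neg (by omega),
    Finset.sum_insert (by simp [hv])]
  omega

theorem code_succ (hK : ∀ v, B.row v ≤ K) {S : Finset V} (hS : S.card < N)
    (hj : ∀ v ∈ S, B.col v ≤ j) :
    B.code N K (j + 1) S = B.code N K j S % N ^ (2 * K) * N ^ (2 * K) := by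
  have h1 : B.colCode N (j + 1) S = 0 := by
    unfold colCode
    rw [Finset.filter_eq_empty_iff.2, Finset.sum_empty]
    intro v hv h
    have := hj v hv
    omega
  unfold code
  rw [h1, Nat.add_mul_mod_self_left, Nat.mod_eq_of_lt (colCode_lt hK hS), Nat.add_sub_cancel,
    zero_add, mul_comm]

/-- The code determines the number of chosen neighbours of a new vertex `v` of the current column:
the vertices of its own column are counted by the lowest digit, those of the preceding column by
the digit with index `threshold v`. -/
theorem nbrCount_eq (hK : ∀ v, B.row v ≤ K) {S : Finset V} (hS : S.card < N) {v : V}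
    (hv : v ∉ S) (hvj : B.col v = j) (hj : ∀ u ∈ S, B.col u ≤ j) :
    nbrCount B.graph S v =
      B.code N K j S / (N ^ (2 * K) * N ^ B.threshold v) % N + B.code N K j S % N := by
  classical
  have hK1 : 1 ≤ K := (B.one_le_row v).trans (hK v)
  have hN : 0 < N := lt_of_le_of_lt (Nat.zero_le _) hS
  have h1 := B.one_le_col v
  have e1 : B.code N K j S / (N ^ (2 * K) * N ^ B.threshold v) =
      B.colCode N (j - 1) S / N ^ B.threshold v := by
    unfold code
    rw [← Nat.div_div_eq_div_mul, Nat.add_mul_div_left _ _ (by positivity),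
      Nat.div_eq_of_lt (colCode_lt hK hS), zero_add]
  have e2 : B.code N K j S % N = B.colCode N j S / N ^ 0 % N := by
    have : N ^ (2 * K) = N * N ^ (2 * K - 1) := by
      rw [← pow_succ']
      congr 1
      omega
    unfold code
    rw [this, mul_assoc, Nat.add_mul_mod_self_left, pow_zero, Nat.div_one]
  rw [e1, e2, colCode_digit hK hS, colCode_digit hK hS, nbrCount,
    ← Finset.card_union_of_disjoint]
  · congr 1
    ext u
    simp only [Finset.mem_filter, Finset.mem_union]
    rw [← and_or_left]
    refine and_congr_right fun hu => ?_
    have huv : u ≠ v := fun h => hv (h ▸ hu)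
    rw [adj_iff_of_col_le B huv (hvj ▸ hj u hu), hvj]
    omega
  · rw [Finset.disjoint_filter]
    intro u _ h h'
    omega

end UBubbleStructure

/-! ### The dynamic program -/

/-- The parameters of one transition between two tables of the dynamic program. -/
structure Transition where
  /-- the place value of the digit counting the neighbours in the preceding column -/
  place : ℕ
  /-- the base of the digits, or `1` if nothing is to be counted -/
  base : ℕ
  /-- the number modulo which a code is reduced -/
  modulus : ℕ
  /-- the factor by which the reduced code is multiplied -/
  factor : ℕ
  /-- the weight added to the code of a set when the new vertex is chosen -/
  weight : ℕ

namespace Transition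

variable (p : Transition)

/-- The new code if the new vertex is not chosen. -/
def keep (X : ℕ) : ℕ := X % p.modulus * p.factor

/-- The new code if the new vertex is chosen. -/
def take (X : ℕ) : ℕ := X % p.modulus * p.factor + p.weight

/-- The number of chosen neighbours of the new vertex. -/
def nbrs (X : ℕ) : ℕ := X / p.place % p.base + X % p.base

/-- The table `f'` arises by the transition `p` from the entries of `f` at the codes `X` with
`a ≤ X < b`, where `Z` is the code of the set of all vertices met so far. The entry `0` means that
a code is not attained; every nonzero entry of `f'` below `b` is the largest value pushed to it. -/
structure Pushes (Z a b : ℕ) (f f' : ℕ → ℕ) : Prop where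
  keep_le : ∀ X, a ≤ X → X < b → f X ≠ 0 → f X + p.nbrs X ≤ f' (p.keep X)
  take_le : ∀ X, a ≤ X → X < b → f X ≠ 0 → f X + (p.nbrs Z - p.nbrs X) ≤ f' (p.take X)
  source : ∀ Y < b, f' Y ≠ 0 → ∃ X, a ≤ X ∧ X < b ∧ f X ≠ 0 ∧
    ((Y = p.keep X ∧ f' Y = f X + p.nbrs X) ∨
      (Y = p.take X ∧ f' Y = f X + (p.nbrs Z - p.nbrs X)))

variable {p} in
theorem Pushes.of_eq_zero {Z a b : ℕ} {f f' : ℕ → ℕ} (h : p.Pushes Z (a + 1) b f f')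
    (h0 : f a = 0) : p.Pushes Z a b f f' := by
  have hne : ∀ X, a ≤ X → f X ≠ 0 → a + 1 ≤ X := by
    intro X h1 h2
    rcases Nat.eq_or_lt_of_le h1 with rfl | h1
    · exact absurd h0 h2
    · exact h1
  refine ⟨fun X h1 h2 h3 => h.keep_le X (hne X h1 h3) h2 h3,
    fun X h1 h2 h3 => h.take_le X (hne X h1 h3) h2 h3, fun Y h1 h2 => ?_⟩
  obtain ⟨X, h3, h4⟩ := h.source Y h1 h2
  exact ⟨X, by omega, h4⟩

/-- Replace the entry of `f` at `a` by `x` if this is larger: with truncated subtraction,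
`f a + (x - f a)` is the maximum of `f a` and `x`. -/
def raise (f : ℕ → ℕ) (a x : ℕ) : ℕ → ℕ := Function.update f a (f a + (x - f a))

theorem le_raise (f : ℕ → ℕ) (a x b : ℕ) : f b ≤ raise f a x b := by
  unfold raise
  by_cases h : b = a
  · subst h
    simp
  · simp [h]

theorem le_raise_self (f : ℕ → ℕ) (a x : ℕ) : x ≤ raise f a x a := by
  simp only [raise, Function.update_self]
  omega

theorem raise_eq (f : ℕ → ℕ) (a x b : ℕ) : raise f a x b = f b ∨ b = a ∧ raise f a x b = x := by
  unfold raise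
  by_cases h : b = a
  · subst h
    rw [Function.update_self]
    rcases le_total x (f b) with h | h
    · exact Or.inl (by omega)
    · exact Or.inr ⟨rfl, by omega⟩
  · exact Or.inl (Function.update_of_ne h _ _)

theorem raise_of_ne (f : ℕ → ℕ) {a b : ℕ} (x : ℕ) (h : b ≠ a) : raise f a x b = f b :=
  Function.update_of_ne h _ _

theorem raise_add (f : ℕ → ℕ) (c a x : ℕ) :
    (fun Y => raise f (c + a) x (c + Y)) = raise (fun Y => f (c + Y)) a x := by
  funext Y
  by_cases h : Y = a
  · subst h
    simp [raise]
  · rw [raise_of_ne _ _ h, raise_of_ne]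
    omega

variable {p} in
theorem Pushes.raise_raise {Z a b : ℕ} {f f' : ℕ → ℕ} (h : p.Pushes Z (a + 1) b f f')
    (hab : a < b) (h0 : f a ≠ 0) :
    p.Pushes Z a b f (raise (raise f' (p.keep a) (f a + p.nbrs a)) (p.take a)
      (f a + (p.nbrs Z - p.nbrs a))) := by
  refine ⟨fun X h1 h2 h3 => ?_, fun X h1 h2 h3 => ?_, fun Y h1 h2 => ?_⟩
  · rcases Nat.eq_or_lt_of_le h1 with rfl | h1
    · exact (le_raise_self _ _ _).trans (le_raise _ _ _ _)
    · exact (h.keep_le X h1 h2 h3).trans ((le_raise _ _ _ _).trans (le_raise _ _ _ _))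
  · rcases Nat.eq_or_lt_of_le h1 with rfl | h1
    · exact le_raise_self _ _ _
    · exact (h.take_le X h1 h2 h3).trans ((le_raise _ _ _ _).trans (le_raise _ _ _ _))
  · rcases raise_eq (raise f' (p.keep a) (f a + p.nbrs a)) (p.take a)
      (f a + (p.nbrs Z - p.nbrs a)) Y with h3 | ⟨h3, h4⟩
    · rw [h3] at h2 ⊢
      rcases raise_eq f' (p.keep a) (f a + p.nbrs a) Y with h5 | ⟨h5, h6⟩
      · rw [h5] at h2 ⊢
        obtain ⟨X, h7, h8⟩ := h.source Y h1 h2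
        exact ⟨X, by omega, h8⟩
      · exact ⟨a, le_rfl, hab, h0, Or.inl ⟨h5, h6⟩⟩
    · exact ⟨a, le_rfl, hab, h0, Or.inr ⟨h3, h4⟩⟩

/-- The transition forgetting the column before the current one. As the base is `1`, no neighbours
are counted, and as the weight is `0`, both targets of a code coincide. -/
def shift (N K : ℕ) : Transition := ⟨1, 1, N ^ (2 * K), N ^ (2 * K), 0⟩

end Transition

namespace UBubbleStructure

variable {V : Type*} {B : UBubbleStructure V} {N K j : ℕ}

/-- The transition adding the vertex `v` of the current column. -/
def transition (B : UBubbleStructure V) (N K : ℕ) (v : V) : Transition :=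
  ⟨N ^ (2 * K) * N ^ B.threshold v, N, N ^ (2 * K) * N ^ (2 * K), 1, B.weight N v⟩

/-- `f` is the table of the dynamic program for the set `U` of vertices met so far: at the code of
a subset it holds one more than the largest cut of `U` by a subset with this code, and
`0` at all numbers that are not codes. -/
structure IsTable (B : UBubbleStructure V) (N K j : ℕ) (U : Finset V) (f : ℕ → ℕ) : Prop where
  le : ∀ S ⊆ U, cutWithin B.graph S U + 1 ≤ f (B.code N K j S)
  attained : ∀ X < N ^ (2 * K) * N ^ (2 * K), f X ≠ 0 →
    ∃ S ⊆ U, B.code N K j S = X ∧ f X = cutWithin B.graph S U + 1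

open Classical in
theorem transition_take_code (hK : ∀ v, B.row v ≤ K) {S : Finset V} {v : V} (hS : S.card < N)
    (hv : v ∉ S) (hvj : B.col v = j) :
    (B.transition N K v).take (B.code N K j S) = B.code N K j (insert v S) := by
  rw [code_insert hv hvj]
  simp [Transition.take, transition, Nat.mod_eq_of_lt (code_lt hK hS)]

theorem shift_take_code (hK : ∀ v, B.row v ≤ K) {S : Finset V} (hS : S.card < N)
    (hj : ∀ u ∈ S, B.col u ≤ j) :
    (Transition.shift N K).take (B.code N K j S) = B.code N K (j + 1) S :=
  (code_succ hK hS hj).symm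

open Classical in
theorem IsTable.pushes_vertex (hK : ∀ v, B.row v ≤ K) {U : Finset V} {v : V}
    (hU : (insert v U).card < N) (hv : v ∉ U) (hvj : B.col v = j) (hj : ∀ u ∈ U, B.col u ≤ j)
    {f f' : ℕ → ℕ} (hf : IsTable B N K j U f)
    (h : (B.transition N K v).Pushes (B.code N K j U) 0 (N ^ (2 * K) * N ^ (2 * K)) f f') :
    IsTable B N K j (insert v U) f' := by
  have hcard : ∀ S ⊆ insert v U, S.card < N := fun S hS => (Finset.card_le_card hS).trans_lt hU
  have hsub : ∀ S ⊆ U, S.card < N := fun S hS => hcard S (hS.trans (Finset.subset_insert _ _))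
  have hnb : ∀ S ⊆ U, (B.transition N K v).nbrs (B.code N K j S) = nbrCount B.graph S v :=
    fun S hS => (nbrCount_eq hK (hsub S hS) (fun h => hv (hS h)) hvj
      fun u hu => hj u (hS hu)).symm
  have hkeep : ∀ S ⊆ U, (B.transition N K v).keep (B.code N K j S) = B.code N K j S := by
    intro S hS
    simp [Transition.keep, transition, Nat.mod_eq_of_lt (code_lt hK (hsub S hS))]
  have htake : ∀ S ⊆ U,
      (B.transition N K v).take (B.code N K j S) = B.code N K j (insert v S) :=
    fun S hS => transition_take_code hK (hsub S hS) (fun h => hv (hS h)) hvj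
  refine ⟨fun S hS => ?_, fun Y hY hfY => ?_⟩
  · by_cases hvS : v ∈ S
    · have hS' : S.erase v ⊆ U := by rwa [← Finset.subset_insert_iff]
      have h1 := hf.le _ hS'
      have h2 := h.take_le _ (Nat.zero_le _) (code_lt (j := j) hK (hsub _ hS')) (by omega)
      rw [htake _ hS', hnb _ hS', hnb U subset_rfl] at h2
      have h3 := cutWithin_insert_insert (G := B.graph) hv hS'
      rw [Finset.insert_erase hvS] at h2 h3
      omega
    · have hS' : S ⊆ U := (Finset.subset_insert_iff_of_notMem hvS).1 hS
      have h1 := hf.le _ hS'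
      have h2 := h.keep_le _ (Nat.zero_le _) (code_lt (j := j) hK (hsub _ hS')) (by omega)
      rw [hkeep _ hS', hnb _ hS'] at h2
      rw [cutWithin_insert_right hv hS']
      omega
  · obtain ⟨X, -, hX, hfX, hc⟩ := h.source Y hY hfY
    obtain ⟨S, hS, rfl, hfS⟩ := hf.attained X hX hfX
    rw [hkeep S hS, htake S hS, hnb S hS, hnb U subset_rfl] at hc
    rcases hc with ⟨rfl, hc⟩ | ⟨rfl, hc⟩
    · refine ⟨S, hS.trans (Finset.subset_insert _ _), rfl, ?_⟩
      rw [cutWithin_insert_right hv hS]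
      omega
    · refine ⟨insert v S, Finset.insert_subset_insert _ hS, rfl, ?_⟩
      rw [cutWithin_insert_insert hv hS]
      omega

theorem IsTable.pushes_shift (hK : ∀ v, B.row v ≤ K) {U : Finset V}
    (hU : U.card < N) (hj : ∀ u ∈ U, B.col u ≤ j) {f f' : ℕ → ℕ} (hf : IsTable B N K j U f)
    (h : (Transition.shift N K).Pushes (B.code N K j U) 0 (N ^ (2 * K) * N ^ (2 * K)) f f') :
    IsTable B N K (j + 1) U f' := by
  have hsub : ∀ S ⊆ U, S.card < N := fun S hS => (Finset.card_le_card hS).trans_lt hU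
  have hnb : ∀ X, (Transition.shift N K).nbrs X = 0 := fun X => by
    simp [Transition.nbrs, Transition.shift, Nat.mod_one]
  have htake : ∀ S ⊆ U,
      (Transition.shift N K).take (B.code N K j S) = B.code N K (j + 1) S := fun S hS =>
    shift_take_code hK (hsub S hS) fun u hu => hj u (hS hu)
  have hkeep : ∀ S ⊆ U,
      (Transition.shift N K).keep (B.code N K j S) = B.code N K (j + 1) S := htake
  refine ⟨fun S hS => ?_, fun Y hY hfY => ?_⟩
  · have h1 := hf.le _ hS
    have h2 := h.keep_le _ (Nat.zero_le _) (code_lt (j := j) hK (hsub _ hS)) (by omega)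
    rw [hkeep S hS] at h2
    omega
  · obtain ⟨X, -, hX, hfX, hc⟩ := h.source Y hY hfY
    obtain ⟨S, hS, rfl, hfS⟩ := hf.attained X hX hfX
    rw [hkeep S hS, htake S hS, hnb, hnb] at hc
    refine ⟨S, hS, ?_, ?_⟩ <;> omega

/-- Once the two columns recorded by the codes are empty, the table has a single nonzero entry,
which gives the size of a maximum cut. -/
theorem IsTable.eq_maxCutSize [Fintype V] (hj : ∀ v, B.col v + 1 < j) {f : ℕ → ℕ}
    (hN : 0 < N) (hf : IsTable B N K j Finset.univ f) : f 0 = maxCutSize B.graph + 1 := by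
  have hcode : ∀ S, B.code N K j S = 0 := by
    intro S
    have h : ∀ i, j - 1 ≤ i → B.colCode N i S = 0 := by
      intro i hi
      unfold colCode
      rw [Finset.filter_eq_empty_iff.2, Finset.sum_empty]
      intro v _ h
      have := hj v
      omega
    rw [code, h _ (Nat.sub_le _ _), h _ le_rfl, mul_zero, add_zero]
  have hle : ∀ S, cutSize B.graph S + 1 ≤ f 0 := fun S => by
    rw [← cutWithin_univ, ← hcode S]
    exact hf.le S (Finset.subset_univ _)
  have h0 : f 0 ≠ 0 := by
    have := hle ∅
    omega
  obtain ⟨S, -, -, hS⟩ := hf.attained 0 (by positivity) h0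
  rw [cutWithin_univ] at hS
  have h1 : cutSize B.graph S ≤ maxCutSize B.graph :=
    Finset.le_sup (f := cutSize B.graph) (Finset.mem_univ S)
  have h2 : maxCutSize B.graph ≤ f 0 - 1 := Finset.sup_le fun T _ => by
    have := hle T
    omega
  omega

/-- The table for the empty set of vertices, whose only cut has size `0` and code `0`. -/
theorem isTable_empty (f : ℕ → ℕ) (h0 : f 0 = 1) (h : ∀ X, X ≠ 0 → f X = 0) :
    IsTable B N K j ∅ f := by
  have hc : B.code N K j ∅ = 0 := by simp [code, colCode]
  refine ⟨fun S hS => ?_, fun X _ hX => ⟨∅, subset_rfl, ?_⟩⟩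
  · rw [Finset.subset_empty.1 hS, hc, h0]
    simp [cutWithin]
  · have : X = 0 := by
      by_contra hne
      exact hX (h X hne)
    subst this
    exact ⟨hc, by rw [h0]; simp [cutWithin]⟩

end UBubbleStructure

/-! ### The program for one transition -/

namespace WordRAM

/-- The register contents during the dynamic program: `n` vertices, base `N`, `M` codes for one
column, `b` codes altogether, the current table at address `L`, the code `Z` of the set of all
vertices met so far, the current column `j`, the numbers `i` and `t` of columns and vertices to
go, the current transition `p`, and the scratch registers `s`. Registers 0 and 1 hold the
constants `0` and `1`; the parameters of `p` are in the registers 11 to 15. -/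
def regs (n N M b L Z j i t : ℕ) (p : Transition) (s : List ℕ) : List ℕ :=
  0 :: 1 :: n :: N :: M :: b :: L :: Z :: j :: i :: t :: p.place :: p.base :: p.modulus ::
    p.factor :: p.weight :: s

/-- Treats one code, the number in register 18 minus one: if the current table has a nonzero entry
there, this entry is pushed to its two targets in the next table. -/
def pushEntry : Prog := block [
  .op .sub 19 18 1, .op .add 20 6 19, .load 20 20,
  .cond 20 (block [
    .op .div 21 19 11, .op .div 22 21 12, .op .mul 22 22 12, .op .sub 21 21 22,
    .op .div 22 19 12, .op .mul 22 22 12, .op .sub 22 19 22, .op .add 21 21 22,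
    .op .div 22 19 13, .op .mul 22 22 13, .op .sub 22 19 22, .op .mul 22 22 14,
    .op .add 22 16 22, .op .add 24 20 21, .load 23 22, .op .sub 24 24 23, .op .add 24 23 24,
    .store 22 24,
    .op .add 22 22 15, .op .sub 24 17 21, .op .add 24 20 24, .load 23 22, .op .sub 24 24 23,
    .op .add 24 23 24, .store 22 24]) .skip,
  .op .sub 18 18 1]

/-- Puts the address of the next table into register 16, the number of neighbours met so far into
register 17, and the number of codes as a counter into register 18. -/
def beginTransition : Prog := block [
  .op .add 16 6 5,
  .op .div 21 7 11, .op .div 22 21 12, .op .mul 22 22 12, .op .sub 21 21 22,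
  .op .div 22 7 12, .op .mul 22 22 12, .op .sub 22 7 22, .op .add 17 21 22,
  .op .add 18 5 0]

/-- Applies the transition to the code of the set of all vertices met so far, and makes the next
table the current one. -/
def endTransition : Prog := block [
  .op .div 22 7 13, .op .mul 22 22 13, .op .sub 22 7 22, .op .mul 22 22 14, .op .add 7 22 15,
  .op .add 6 16 0]

/-- Performs the transition whose parameters are in the registers 11 to 15. -/
def performTransition : Prog :=
  .seq beginTransition (.seq (.loop 18 pushEntry) endTransition)

theorem exists_of_length_six {s : List ℕ} (h : s.length = 6) :
    ∃ a b c d e f, s = [a, b, c, d, e, f] := by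
  match s, h with
  | [a, b, c, d, e, f], _ => exact ⟨a, b, c, d, e, f, rfl⟩

theorem exists_of_length_nine {s : List ℕ} (h : s.length = 9) :
    ∃ a b c d e f g i j, s = [a, b, c, d, e, f, g, i, j] := by
  match s, h with
  | [a, b, c, d, e, f, g, i, j], _ => exact ⟨a, b, c, d, e, f, g, i, j, rfl⟩

variable {w n N M b L Z j i t : ℕ} {p : Transition} {m : ℕ → ℕ}

open Transition in
/-- Register 16 holds the address `A` of the next table, register 17 the number `z` of all
neighbours met so far, and register 18 the counter. -/
theorem pushEntry_achieves {A z x : ℕ} {s : List ℕ} (hs : s.length = 6) (hx : L + x < 2 ^ w)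
    (hm : m (L + x) < 2 ^ w)
    (h : m (L + x) ≠ 0 → A + p.take x < 2 ^ w ∧ m (L + x) + p.nbrs x < 2 ^ w ∧
      m (L + x) + (z - p.nbrs x) < 2 ^ w ∧ m (A + p.keep x) < 2 ^ w ∧ m (A + p.take x) < 2 ^ w) :
    Achieves w pushEntry pushEntry.cost
      (regs n N M b L Z j i t p (A :: z :: (x + 1) :: s)) m
      (fun l' m' => (∃ s', s'.length = 6 ∧ l' = regs n N M b L Z j i t p (A :: z :: x :: s')) ∧
        m' = if m (L + x) = 0 then m else
          raise (raise m (A + p.keep x) (m (L + x) + p.nbrs x)) (A + p.take x)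
            (m (L + x) + (z - p.nbrs x))) := by
  obtain ⟨s19, s20, s21, s22, s23, s24, rfl⟩ := exists_of_length_six hs
  have hraise : ∀ (f : ℕ → ℕ) (a y : ℕ), Function.update f a (f a + (y - f a)) = raise f a y :=
    fun _ _ _ => rfl
  have hself : ∀ (f : ℕ → ℕ) (a y : ℕ), f a + (y - f a) = raise f a y a := fun f a y => by
    simp [raise]
  refine Achieves.of_vc ?_
  simp only [pushEntry, regs, block, VC, Op.eval, List.getD_cons_zero, List.getD_cons_succ,
    List.set_cons_zero, List.set_cons_succ, Nat.add_sub_cancel, ← Nat.mod_eq_sub_div_mul, hraise]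
  refine ⟨by simp, by omega, by simp, hx, by simp, hm, fun h0 => ?_, fun h0 => ?_⟩
  · obtain ⟨h1, h2, h3, h4, h5⟩ := h h0
    rw [if_neg h0]
    simp only [Transition.take, Transition.keep, Transition.nbrs] at h1 h2 h3 h4 h5 ⊢
    have e1 := Nat.div_le_self x p.place
    have e2 := Nat.div_mul_le_self (x / p.place) p.base
    have e3 := Nat.div_le_self (x / p.place) p.base
    have e4 := Nat.div_le_self x p.base
    have e5 := Nat.div_mul_le_self x p.base
    have e6 := Nat.div_le_self x p.modulus
    have e7 := Nat.div_mul_le_self x p.modulus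
    have e8 := Nat.mod_le x p.modulus
    have e9 : raise m (A + x % p.modulus * p.factor)
        (m (L + x) + (x / p.place % p.base + x % p.base))
        (A + x % p.modulus * p.factor + p.weight) < 2 ^ w := by
      rcases raise_eq m (A + x % p.modulus * p.factor)
        (m (L + x) + (x / p.place % p.base + x % p.base))
        (A + x % p.modulus * p.factor + p.weight) with h | h
      · rw [h, Nat.add_assoc A]
        exact h5
      · rw [h.2]
        exact h2
    rw [← Nat.add_assoc A] at h1 h5
    rw [← Nat.add_assoc A]
    refine ⟨by simp, by omega, by simp, by omega, by simp, by omega, by simp, by omega,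
      by simp, by omega, by simp, by omega, by simp, by omega, by simp, by omega,
      by simp, by omega, by simp, by omega, by simp, by omega, by simp, by omega,
      by simp, by omega, by simp, by omega, by simp, by omega, by simp, by omega,
      by simp, by omega, by omega, by simp, by omega, by simp, by omega, by simp, by omega,
      by simp, e9, by simp, by omega, by simp, by omega, by omega, by simp, by omega,
      ⟨_, ?_, rfl⟩, rfl⟩
    rfl
  · rw [if_pos h0]
    exact ⟨by simp, by omega, ⟨_, rfl, rfl⟩, rfl⟩

theorem _root_.Transition.Pushes.lt {W a : ℕ} {f f' : ℕ → ℕ} (h : p.Pushes Z a b f f')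
    (hf : ∀ X < b, f X ≠ 0 → f X + p.nbrs X < W ∧ f X + (p.nbrs Z - p.nbrs X) < W)
    (hW : 0 < W) {Y : ℕ} (hY : Y < b) : f' Y < W := by
  by_cases h0 : f' Y = 0
  · omega
  · obtain ⟨X, -, hX, hfX, hc⟩ := h.source Y hY h0
    have := hf X hX hfX
    omega

open Transition in
/-- The memory behind the current table has to be `0`, and the hypothesis `hf` keeps all pushes inside
the next table and inside `w` bits. -/
theorem performTransition_achieves {s : List ℕ} (hs : s.length = 9)
    (hw : L + 2 * b < 2 ^ w) (hZ : Z < b) (hZ' : p.take Z < b) (hn : p.nbrs Z < 2 ^ w)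
    (hm : ∀ a, L + b ≤ a → m a = 0)
    (hf : ∀ X < b, m (L + X) ≠ 0 → p.take X < b ∧ m (L + X) + p.nbrs X < 2 ^ w ∧
      m (L + X) + (p.nbrs Z - p.nbrs X) < 2 ^ w) :
    Achieves w performTransition (b * (pushEntry.cost + 1) + 20)
      (regs n N M b L Z j i t p s) m
      (fun l' m' =>
        (∃ s', s'.length = 9 ∧ l' = regs n N M b (L + b) (p.take Z) j i t p s') ∧
        (∀ a < L + b, m' a = m a) ∧ (∀ a, L + b + b ≤ a → m' a = 0) ∧
        p.Pushes Z 0 b (fun X => m (L + X)) (fun Y => m' (L + b + Y))) := by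
  obtain ⟨s16, s17, s18, s19, s20, s21, s22, s23, s24, rfl⟩ := exists_of_length_nine hs
  have hz1 := Nat.div_le_self Z p.place
  have hz2 := Nat.div_mul_le_self (Z / p.place) p.base
  have hz3 := Nat.div_le_self (Z / p.place) p.base
  have hz4 := Nat.div_le_self Z p.base
  have hz5 := Nat.div_mul_le_self Z p.base
  have hz6 := Nat.div_le_self Z p.modulus
  have hz7 := Nat.div_mul_le_self Z p.modulus
  have hz8 := Nat.mod_le Z p.modulus
  have hz0 := Nat.mod_le (Z / p.place) p.base
  have hz9 := Nat.mod_le Z p.base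
  have hf' : ∀ X < b, m (L + X) ≠ 0 →
      m (L + X) + p.nbrs X < 2 ^ w ∧ m (L + X) + (p.nbrs Z - p.nbrs X) < 2 ^ w :=
    fun X hX h => (hf X hX h).2
  have hbegin : Achieves w beginTransition beginTransition.cost
      (regs n N M b L Z j i t p [s16, s17, s18, s19, s20, s21, s22, s23, s24]) m
      (fun l' m' => (∃ s', s'.length = 6 ∧
        l' = regs n N M b L Z j i t p ((L + b) :: p.nbrs Z :: b :: s')) ∧ m' = m) := by
    refine Achieves.of_vc ?_
    simp only [beginTransition, regs, block, VC, Op.eval, List.getD_cons_zero,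
      List.getD_cons_succ, List.set_cons_zero, List.set_cons_succ, ← Nat.mod_eq_sub_div_mul,
      Nat.add_zero]
    refine ⟨by simp, by omega, by simp, by omega, by simp, by omega, by simp, by omega,
      by simp, by omega, by simp, by omega, by simp, by omega, by simp, by omega,
      by simp, hn, by simp, by omega, ⟨_, ?_, rfl⟩, trivial⟩
    rfl
  have hloop := Achieves.loop (w := w) (x := 18) (p := pushEntry) (T := pushEntry.cost)
    (fun x l' m' => (∃ s', s'.length = 6 ∧
        l' = regs n N M b L Z j i t p ((L + b) :: p.nbrs Z :: x :: s')) ∧ x ≤ b ∧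
      (∀ a < L + b, m' a = m a) ∧ (∀ a, L + b + b ≤ a → m' a = 0) ∧
      p.Pushes Z x b (fun X => m (L + X)) (fun Y => m' (L + b + Y)))
    (by
      rintro x l' m' ⟨⟨s', -, rfl⟩, -⟩
      rfl)
    (by
      rintro x l' m' ⟨⟨s', hs', rfl⟩, hxb, hlow, hhigh, hp⟩
      have hx : m' (L + x) = m (L + x) := hlow _ (by omega)
      have hnext : ∀ Y < b, m' (L + b + Y) < 2 ^ w :=
        fun Y hY => hp.lt hf' (by positivity) hY
      refine (pushEntry_achieves hs' (by omega) ?_ ?_).mono le_rfl ?_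
      · rw [hx]
        by_cases h0 : m (L + x) = 0
        · rw [h0]
          positivity
        · have := (hf' x (by omega) h0).1
          omega
      · intro h0
        rw [hx] at h0 ⊢
        obtain ⟨h1, h2, h3⟩ := hf x (by omega) h0
        exact ⟨by omega, h2, h3, hnext _ (lt_of_le_of_lt (Nat.le_add_right _ _) h1),
          hnext _ h1⟩
      · rintro l'' m'' ⟨hl'', rfl⟩
        refine ⟨hl'', by omega, ?_⟩
        by_cases h0 : m (L + x) = 0
        · rw [if_pos (hx.trans h0)]
          exact ⟨hlow, hhigh, hp.of_eq_zero h0⟩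
        · rw [if_neg (hx ▸ h0), hx]
          obtain ⟨h1, h2, h3⟩ := hf x (by omega) h0
          have h4 : p.keep x < b := lt_of_le_of_lt (Nat.le_add_right _ _) h1
          refine ⟨fun a ha => ?_, fun a ha => ?_, ?_⟩
          · rw [raise_of_ne _ _ (by omega), raise_of_ne _ _ (by omega), hlow a ha]
          · rw [raise_of_ne _ _ (by omega), raise_of_ne _ _ (by omega), hhigh a ha]
          · rw [raise_add, raise_add]
            exact hp.raise_raise (by omega) h0)
  refine (hbegin.seq (T₂ := b * (pushEntry.cost + 1) + 1 + endTransition.cost) ?_).mono ?_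
    fun _ _ => id
  · rintro l' m' ⟨⟨s', hs', rfl⟩, rfl⟩
    refine (hloop b _ m' ⟨⟨s', hs', rfl⟩, le_rfl, fun _ _ => rfl,
      fun a ha => hm a (by omega), ⟨?_, ?_, ?_⟩⟩).seq ?_
    · intro X h1 h2
      omega
    · intro X h1 h2
      omega
    · intro Y _ hY
      exact absurd (hm _ (by omega)) hY
    · rintro l'' m'' ⟨⟨s'', hs'', rfl⟩, -, hlow, hhigh, hp⟩
      obtain ⟨s19, s20, s21, s22, s23, s24, rfl⟩ := exists_of_length_six hs''
      refine Achieves.of_vc ?_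
      unfold Transition.take at hZ' ⊢
      simp only [endTransition, regs, block, VC, Op.eval, List.getD_cons_zero,
        List.getD_cons_succ, List.set_cons_zero, List.set_cons_succ,
        ← Nat.mod_eq_sub_div_mul, Nat.add_zero]
      refine ⟨by simp, by omega, by simp, by omega, by simp, by omega, by simp, by omega,
        by simp, by omega, by simp, by omega, ⟨_, ?_, rfl⟩, hlow, hhigh, hp⟩
      rfl
  · simp only [beginTransition, endTransition, block, Prog.cost]
    omega

end WordRAM

/-! ### The program for maximum cut -/

namespace WordRAM

/-- Loads the column of the vertex with number `t - 1` (`t` in register 10), and puts a nonzero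
number into register 22 iff this is not the current column. -/
def compareColumn : Prog := block [
  .const 19 4, .op .mul 19 19 10, .const 20 2, .op .sub 20 19 20, .load 21 20,
  .op .sub 22 21 8, .op .sub 23 8 21, .op .add 22 22 23]

/-- Loads the place of a vertex and puts its threshold and the successor of its key into the
registers 21 and 22; the place value and the weight start as the factors of the powers to come. -/
def loadVertex : Prog := block [
  .load 23 19, .op .sub 20 19 1, .load 24 20, .const 20 3, .op .sub 20 19 20, .load 20 20,
  .op .add 20 20 20, .op .sub 21 20 24, .op .add 22 20 23, .op .sub 22 22 1,
  .op .add 11 4 0, .op .add 12 3 0, .op .add 13 5 0, .op .add 14 1 0, .op .add 15 1 0]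

/-- Puts the parameters of the transition for a vertex of the current column into the
registers 11 to 15. -/
def setVertexTransition : Prog :=
  .seq loadVertex (.seq (powLoop 11 3 21 1) (.seq (powLoop 15 3 22 1)
    (block [.op .sub 15 15 1, .op .div 15 15 2])))

/-- Performs the transition for one vertex if it lies in the current column. -/
def treatVertex : Prog :=
  .seq compareColumn (.seq (.cond 22 .skip (.seq setVertexTransition performTransition))
    (.op .sub 10 10 1))

/-- Puts the parameters of the transition to the next column into the registers 11 to 15. -/
def setShift : Prog := block [
  .op .add 11 1 0, .op .add 12 1 0, .op .add 13 4 0, .op .add 14 4 0, .op .add 15 0 0]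

/-- Treats the vertices of the current column and goes on to the next one. -/
def treatColumn : Prog :=
  .seq (.op .add 10 2 0) (.seq (.loop 10 treatVertex) (.seq setShift (.seq performTransition
    (block [.op .add 8 8 1, .op .sub 9 9 1]))))

/-- Replaces register 21 by the row of the vertex with number `t - 1` if this is larger. -/
def updateRows : Prog := block [
  .const 19 4, .op .mul 19 19 10, .const 20 3, .op .sub 19 19 20, .load 20 19,
  .op .sub 20 20 21, .op .add 21 21 20, .op .sub 10 10 1]

/-- Computes the number of rows and sets up the first table. -/
def setUp : Prog :=
  .seq (block [.const 1 1, .load 2 0, .op .add 3 2 1, .op .add 10 2 0])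
    (.seq (.loop 10 updateRows) (.seq (block [.op .add 21 21 21, .op .add 4 1 0])
      (.seq (powLoop 4 3 21 1) (block [.op .mul 5 4 4, .const 19 4, .op .mul 6 19 2,
        .op .add 6 6 1, .op .add 6 6 5, .store 6 1, .op .add 8 1 0, .op .add 9 3 0]))))

/-- The program computing the size of a maximum cut. -/
def maxCutProgram : Prog :=
  .seq setUp (.seq (.loop 9 treatColumn) (block [.load 20 6, .op .sub 0 20 1]))

end WordRAM

/-! ### The contents of the memory -/

namespace UBubbleStructure

variable {V : Type*} {n : ℕ} (B : UBubbleStructure V) (e : Fin n ≃ V)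

theorem encode_row {t : ℕ} (ht : t < n) : B.encode e (4 * (t + 1) - 3) = B.row (e ⟨t, ht⟩) := by
  have h1 : (4 * (t + 1) - 3 - 1) / 4 = t := by omega
  have h2 : (4 * (t + 1) - 3 - 1) % 4 = 0 := by omega
  have h3 : 4 * (t + 1) - 3 ≠ 0 := by omega
  simp only [encode, h1, h2, h3, ht, if_false, dif_pos]

theorem encode_col {t : ℕ} (ht : t < n) : B.encode e (4 * (t + 1) - 2) = B.col (e ⟨t, ht⟩) := by
  have h1 : (4 * (t + 1) - 2 - 1) / 4 = t := by omega
  have h2 : (4 * (t + 1) - 2 - 1) % 4 = 1 := by omega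
  have h3 : 4 * (t + 1) - 2 ≠ 0 := by omega
  simp only [encode, h1, h2, h3, ht, if_false, dif_pos]

theorem encode_leftClosed {t : ℕ} (ht : t < n) :
    B.encode e (4 * (t + 1) - 1) = (B.leftClosed (e ⟨t, ht⟩)).toNat := by
  have h1 : (4 * (t + 1) - 1 - 1) / 4 = t := by omega
  have h2 : (4 * (t + 1) - 1 - 1) % 4 = 2 := by omega
  have h3 : 4 * (t + 1) - 1 ≠ 0 := by omega
  simp only [encode, h1, h2, h3, ht, if_false, dif_pos]

theorem encode_rightClosed {t : ℕ} (ht : t < n) :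
    B.encode e (4 * (t + 1)) = (B.rightClosed (e ⟨t, ht⟩)).toNat := by
  have h1 : (4 * (t + 1) - 1) / 4 = t := by omega
  have h2 : (4 * (t + 1) - 1) % 4 = 3 := by omega
  have h3 : 4 * (t + 1) ≠ 0 := by omega
  simp only [encode, h1, h2, h3, ht, if_false, dif_pos]

theorem encode_eq_zero {a : ℕ} (ha : 4 * n < a) : B.encode e a = 0 := by
  have h1 : a ≠ 0 := by omega
  have h2 : ¬ (a - 1) / 4 < n := by omega
  simp only [encode, h1, h2, if_false, dif_neg, not_false_eq_true]

/-- The vertices treated before the vertices with numbers below `t` of column `j`. -/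
def met [Fintype V] (j t : ℕ) : Finset V :=
  {v | B.col v < j ∨ B.col v = j ∧ t ≤ (e.symm v : ℕ)}

/-- The number of codes. -/
def numCodes (n K : ℕ) : ℕ := (n + 1) ^ (2 * K) * (n + 1) ^ (2 * K)

/-- The address of the table for the set `U` in column `j`: it is behind the input and the tables
of the preceding transitions, one for each vertex in `U` and one for each column left. -/
def tableAddr (n K j : ℕ) (U : Finset V) : ℕ := 4 * n + 1 + (U.card + j) * numCodes n K

/-- The invariant of the program: the memory holds the input and the table for `U` in column `j`,
and the registers hold what belongs to them, with `c` as the current column. -/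
structure Ready (K j c i t : ℕ) (U : Finset V) (p : Transition) (l : List ℕ) (m : ℕ → ℕ) :
    Prop where
  regs : ∃ s, s.length = 9 ∧ l = WordRAM.regs n (n + 1) ((n + 1) ^ (2 * K)) (numCodes n K)
    (tableAddr n K j U) (B.code (n + 1) K j U) c i t p s
  table : B.IsTable (n + 1) K j U fun X => m (tableAddr n K j U + X)
  input : ∀ a ≤ 4 * n, m a = B.encode e a
  zero : ∀ a, tableAddr n K j U + numCodes n K ≤ a → m a = 0

end UBubbleStructure

/-! ### Correctness of single transitions -/

namespace WordRAM

open UBubbleStructure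

variable {V : Type*} {n : ℕ} {B : UBubbleStructure V} {e : Fin n ≃ V} {K w j c i t : ℕ}
  {U : Finset V} {p : Transition} {l : List ℕ} {m : ℕ → ℕ}

theorem sq_le_numCodes (hK : 1 ≤ K) : (n + 1) * (n + 1) ≤ numCodes n K := by
  have h : n + 1 ≤ (n + 1) ^ (2 * K) := Nat.le_self_pow (by omega) _
  exact Nat.mul_le_mul h h

theorem sixteen_le_numCodes (hn : 1 ≤ n) (hK : 1 ≤ K) : 16 ≤ numCodes n K := by
  have h : 2 ^ 2 ≤ (n + 1) ^ (2 * K) :=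
    (Nat.pow_le_pow_left (by omega : 2 ≤ n + 1) 2).trans
      (Nat.pow_le_pow_right (by omega) (by omega))
  exact Nat.mul_le_mul h h

theorem two_mul_le_numCodes (hn : 1 ≤ n) : 2 * K ≤ numCodes n K := by
  have h : 2 * K < (n + 1) ^ (2 * K) := Nat.lt_pow_self (by omega)
  exact h.le.trans (Nat.le_mul_of_pos_right _ (by positivity))

/-- A transition that is correct for tables turns the invariant for `U` in column `j` into the one
for `U'` in column `j'`. Its register for the current column is left alone: after a shift it has to
be updated separately. -/
theorem performTransition_ready {U' : Finset V} {j' : ℕ}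
    (h : Ready B e K j c i t U p l m) (hK1 : 1 ≤ K) (hK : ∀ v, B.row v ≤ K)
    (hw : 4 * n + 1 + (2 * n + 6) * numCodes n K < 2 ^ w) (hj : j ≤ n + 2)
    (hbase : 0 < p.base) (hbase' : p.base ≤ n + 1)
    (htake : ∀ S ⊆ U, p.take (B.code (n + 1) K j S) < numCodes n K)
    (hcard : U'.card + j' = U.card + j + 1)
    (hcode : p.take (B.code (n + 1) K j U) = B.code (n + 1) K j' U')
    (htable : ∀ f f', IsTable B (n + 1) K j U f →
      p.Pushes (B.code (n + 1) K j U) 0 (numCodes n K) f f' → IsTable B (n + 1) K j' U' f') :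
    Achieves w performTransition (numCodes n K * (pushEntry.cost + 1) + 20) l m
      (fun l' m' => Ready B e K j' c i t U' p l' m') := by
  obtain ⟨⟨s, hs, rfl⟩, ht, hin, hz⟩ := h
  have : Fintype V := Fintype.ofEquiv _ e
  have hcardV : Fintype.card V = n := by rw [Fintype.card_congr e.symm, Fintype.card_fin]
  have hU : U.card ≤ n := hcardV ▸ Finset.card_le_univ U
  have hsq := sq_le_numCodes (n := n) hK1
  have haddr : tableAddr n K j' U' = tableAddr n K j U + numCodes n K := by
    unfold tableAddr
    rw [hcard]
    ring
  have hL : tableAddr n K j U ≤ 4 * n + 1 + (2 * n + 2) * numCodes n K :=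
    Nat.add_le_add_left (Nat.mul_le_mul_right _ (by omega)) _
  have hL' : 4 * n + 1 ≤ tableAddr n K j U := Nat.le_add_right _ _
  have hexp : (2 * n + 6) * numCodes n K =
      (2 * n + 2) * numCodes n K + 4 * numCodes n K := by ring
  have hnb : ∀ X, p.nbrs X ≤ 2 * n := by
    intro X
    have h1 := Nat.mod_lt (X / p.place) hbase
    have h2 := Nat.mod_lt X hbase
    unfold Transition.nbrs
    omega
  have hsmall : n * n + 1 + 2 * n < 2 ^ w := by
    have : (n + 1) * (n + 1) = n * n + 1 + 2 * n := by ring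
    omega
  refine (performTransition_achieves (b := numCodes n K) hs (by omega)
    (code_lt hK (by omega)) (htake U subset_rfl)
    (by have := hnb (B.code (n + 1) K j U); omega) hz ?_).mono le_rfl ?_
  · intro X hX hfX
    obtain ⟨S, hS, rfl, hfS⟩ := ht.attained X hX hfX
    have h1 := cutWithin_le (G := B.graph) S U
    rw [hcardV] at h1
    have h2 := hnb (B.code (n + 1) K j S)
    have h3 := hnb (B.code (n + 1) K j U)
    refine ⟨htake S hS, ?_, ?_⟩ <;> omega
  · rintro l' m' ⟨⟨s', hs', rfl⟩, hlow, hhigh, hp⟩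
    refine ⟨⟨s', hs', by rw [haddr, hcode]⟩, ?_, fun a ha => ?_, fun a ha => ?_⟩
    · rw [haddr]
      exact htable _ _ ht hp
    · rw [hlow a (by omega), hin a ha]
    · rw [haddr] at ha
      exact hhigh a ha

/-- The digits of a weight form a geometric progression. -/
theorem weight_eq_div (hn : 1 ≤ n) (v : V) :
    B.weight (n + 1) v = ((n + 1) ^ (B.key v + 1) - 1) / n := by
  rw [UBubbleStructure.weight, Nat.geomSum_eq (by omega)]
  rfl

theorem setVertexTransition_achieves (hn : 1 ≤ n) (hK : ∀ v, B.row v ≤ K)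
    (hw : 4 * n + 1 + (2 * n + 6) * numCodes n K < 2 ^ w) {L Z a b d f g h x y : ℕ}
    (hin : ∀ a ≤ 4 * n, m a = B.encode e a) (ht : t < n) :
    Achieves w setVertexTransition (16 * K + 24)
      (regs n (n + 1) ((n + 1) ^ (2 * K)) (numCodes n K) L Z j i (t + 1) p
        [a, b, d, 4 * (t + 1), f, g, h, x, y]) m
      (fun l' m' => (∃ s, s.length = 9 ∧ l' = regs n (n + 1) ((n + 1) ^ (2 * K)) (numCodes n K)
        L Z j i (t + 1) (B.transition (n + 1) K (e ⟨t, ht⟩)) s) ∧ m' = m) := by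
  set v := e ⟨t, ht⟩ with hv
  have hK1 : 1 ≤ K := (B.one_le_row v).trans (hK v)
  have hrow := B.one_le_row v
  have hrowK := hK v
  have hKb := two_mul_le_numCodes (K := K) hn
  have h16 := sixteen_le_numCodes hn hK1
  have hexp : (2 * n + 6) * numCodes n K =
      2 * (n * numCodes n K) + 6 * numCodes n K := by ring
  have hM : (n + 1) ^ (2 * K) ≤ numCodes n K := Nat.le_mul_of_pos_right _ (by positivity)
  have hnM : n + 1 ≤ (n + 1) ^ (2 * K) := Nat.le_self_pow (by omega) _
  have hrc := Bool.toNat_le (B.rightClosed v)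
  have hlc := Bool.toNat_le (B.leftClosed v)
  have hthr : B.row v + B.row v - (B.leftClosed v).toNat = B.threshold v := by
    rw [← two_mul]
    rfl
  have hkey : B.row v + B.row v + (B.rightClosed v).toNat - 1 = B.key v + 1 := by
    unfold UBubbleStructure.key
    omega
  have hkeyK := B.key_lt hrowK
  have hplace : (n + 1) ^ (2 * K) * (n + 1) ^ B.threshold v ≤ numCodes n K :=
    Nat.mul_le_mul_left _ (Nat.pow_le_pow_right (by omega) (by omega))
  have hweight : (n + 1) ^ (B.key v + 1) ≤ (n + 1) ^ (2 * K) :=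
    Nat.pow_le_pow_right (by omega) (by omega)
  have hload : Achieves w loadVertex loadVertex.cost
      (regs n (n + 1) ((n + 1) ^ (2 * K)) (numCodes n K) L Z j i (t + 1) p
        [a, b, d, 4 * (t + 1), f, g, h, x, y]) m
      (fun l' m' => (∃ f x y, l' = regs n (n + 1) ((n + 1) ^ (2 * K)) (numCodes n K)
        L Z j i (t + 1) ⟨(n + 1) ^ (2 * K), n + 1, numCodes n K, 1, 1⟩
        [a, b, d, 4 * (t + 1), f, B.threshold v, B.key v + 1, x, y]) ∧ m' = m) := by
    have e1 : m (4 * (t + 1)) = (B.rightClosed v).toNat := by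
      rw [hin _ (by omega), encode_rightClosed B e ht]
    have e2 : m (4 * (t + 1) - 1) = (B.leftClosed v).toNat := by
      rw [hin _ (by omega), encode_leftClosed B e ht]
    have e3 : m (4 * (t + 1) - 3) = B.row v := by
      rw [hin _ (by omega), encode_row B e ht]
    refine Achieves.of_vc ?_
    simp only [loadVertex, regs, block, VC, Op.eval, List.getD_cons_zero,
      List.getD_cons_succ, List.set_cons_zero, List.set_cons_succ, Nat.add_zero, e1, e2, e3,
      hthr, hkey]
    refine ⟨by simp, by omega, by simp, by omega, by simp, by omega, by simp, by omega,
      by simp, by omega, by simp, by omega, by simp, by omega, by simp, by omega, by simp,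
      by omega, by simp, by omega, by simp, by omega, by simp, by omega, by simp, by omega,
      by simp, by omega, by simp, by omega, ⟨_, _, _, rfl⟩, trivial⟩
  have hpow₁ : ∀ f x y, Achieves w (powLoop 11 3 21 1) (8 * K + 1)
      (regs n (n + 1) ((n + 1) ^ (2 * K)) (numCodes n K)
        L Z j i (t + 1) ⟨(n + 1) ^ (2 * K), n + 1, numCodes n K, 1, 1⟩
        [a, b, d, 4 * (t + 1), f, B.threshold v, B.key v + 1, x, y]) m
      (fun l' m' => l' = regs n (n + 1) ((n + 1) ^ (2 * K)) (numCodes n K)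
        L Z j i (t + 1) ⟨(n + 1) ^ (2 * K) * (n + 1) ^ B.threshold v, n + 1, numCodes n K, 1, 1⟩
        [a, b, d, 4 * (t + 1), f, 0, B.key v + 1, x, y] ∧ m' = m) := by
    intro f x y
    refine Achieves.mono (powLoop_achieves m (by simp [regs]) (by simp [regs]) rfl
      (Nat.le_add_left _ _) (by simp) (by simp) (by simp) (by simp) (by simp)
      (lt_of_le_of_lt hplace (by omega)) ?_) ?_ ?_
    · change B.threshold v < 2 ^ w
      omega
    · change B.threshold v * 4 + 1 ≤ _
      omega
    · rintro _ _ ⟨rfl, rfl⟩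
      exact ⟨rfl, rfl⟩
  have hpow₂ : ∀ f x y, Achieves w (powLoop 15 3 22 1) (8 * K + 1)
      (regs n (n + 1) ((n + 1) ^ (2 * K)) (numCodes n K)
        L Z j i (t + 1) ⟨(n + 1) ^ (2 * K) * (n + 1) ^ B.threshold v, n + 1, numCodes n K, 1, 1⟩
        [a, b, d, 4 * (t + 1), f, 0, B.key v + 1, x, y]) m
      (fun l' m' => l' = regs n (n + 1) ((n + 1) ^ (2 * K)) (numCodes n K)
        L Z j i (t + 1) ⟨(n + 1) ^ (2 * K) * (n + 1) ^ B.threshold v, n + 1, numCodes n K, 1,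
          1 * (n + 1) ^ (B.key v + 1)⟩
        [a, b, d, 4 * (t + 1), f, 0, 0, x, y] ∧ m' = m) := by
    intro f x y
    refine Achieves.mono (powLoop_achieves m (by simp [regs]) (by simp [regs]) rfl
      (Nat.le_add_left _ _) (by simp) (by simp) (by simp) (by simp) (by simp) ?_ ?_) ?_ ?_
    · change 1 * (n + 1) ^ (B.key v + 1) < 2 ^ w
      omega
    · change B.key v + 1 < 2 ^ w
      omega
    · change (B.key v + 1) * 4 + 1 ≤ _
      omega
    · rintro _ _ ⟨rfl, rfl⟩
      exact ⟨rfl, rfl⟩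
  refine (hload.seq (T₂ := 8 * K + 1 + (8 * K + 1 + 3)) ?_).mono ?_ fun _ _ => id
  · rintro _ _ ⟨⟨f, x, y, rfl⟩, rfl⟩
    refine (hpow₁ f x y).seq ?_
    rintro _ _ ⟨rfl, rfl⟩
    refine (hpow₂ f x y).seq ?_
    rintro _ _ ⟨rfl, rfl⟩
    refine Achieves.of_vc ?_
    have e1 : ((n + 1) ^ (B.key v + 1) - 1) / n = B.weight (n + 1) v := (weight_eq_div hn v).symm
    have e2 : B.weight (n + 1) v ≤ (n + 1) ^ (B.key v + 1) := by
      rw [← e1]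
      exact (Nat.div_le_self _ _).trans (Nat.sub_le _ _)
    simp only [regs, block, VC, Op.eval, List.getD_cons_zero, List.getD_cons_succ,
      List.set_cons_zero, List.set_cons_succ, one_mul, e1]
    exact ⟨by simp, by omega, by simp, by omega, ⟨_, rfl, rfl⟩, trivial⟩
  · simp only [loadVertex, block, Prog.cost]
    omega

end WordRAM

/-! ### Correctness and running time of the program -/

namespace UBubbleStructure

variable {V : Type*} [Fintype V] {n : ℕ} {B : UBubbleStructure V} {e : Fin n ≃ V} {j t : ℕ}

theorem mem_met {v : V} :
    v ∈ B.met e j t ↔ B.col v < j ∨ B.col v = j ∧ t ≤ (e.symm v : ℕ) := by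
  simp [met]

open Classical in
theorem met_of_col_eq (ht : t < n) (h : B.col (e ⟨t, ht⟩) = j) :
    B.met e j t = insert (e ⟨t, ht⟩) (B.met e j (t + 1)) := by
  ext v
  obtain ⟨⟨x, hx⟩, rfl⟩ := e.surjective v
  rw [Finset.mem_insert, mem_met, mem_met, e.injective.eq_iff, Fin.mk.injEq,
    Equiv.symm_apply_apply]
  constructor
  · rintro (h' | ⟨h1, h2⟩)
    · exact Or.inr (Or.inl h')
    · rcases Nat.eq_or_lt_of_le h2 with h3 | h3
      · exact Or.inl h3.symm
      · exact Or.inr (Or.inr ⟨h1, h3⟩)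
  · rintro (rfl | h' | ⟨h1, h2⟩)
    · exact Or.inr ⟨h, le_rfl⟩
    · exact Or.inl h'
    · exact Or.inr ⟨h1, Nat.le_of_succ_le h2⟩

theorem met_of_col_ne (ht : t < n) (h : B.col (e ⟨t, ht⟩) ≠ j) :
    B.met e j t = B.met e j (t + 1) := by
  ext v
  obtain ⟨⟨x, hx⟩, rfl⟩ := e.surjective v
  rw [mem_met, mem_met, Equiv.symm_apply_apply]
  refine or_congr_right (and_congr_right fun hc => ?_)
  have : t ≠ x := by
    rintro rfl
    exact h hc
  simp only
  omega

theorem notMem_met (ht : t < n) (h : B.col (e ⟨t, ht⟩) = j) :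
    e ⟨t, ht⟩ ∉ B.met e j (t + 1) := by
  rw [mem_met, Equiv.symm_apply_apply]
  simp only
  omega

theorem met_zero : B.met e j 0 = B.met e (j + 1) n := by
  ext v
  rw [mem_met, mem_met]
  have := (e.symm v).isLt
  omega

theorem col_le_of_mem_met {v : V} (h : v ∈ B.met e j t) : B.col v ≤ j := by
  rw [mem_met] at h
  omega

theorem met_one : B.met e 1 n = ∅ := by
  rw [Finset.eq_empty_iff_forall_notMem]
  intro v
  rw [mem_met]
  have := B.one_le_col v
  have := (e.symm v).isLt
  omega

end UBubbleStructure

namespace WordRAM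

open UBubbleStructure

variable {V : Type*} [Fintype V] {n : ℕ} {B : UBubbleStructure V} {e : Fin n ≃ V}
  {K w j i t : ℕ} {p : Transition} {l : List ℕ} {m : ℕ → ℕ}

theorem card_lt_succ (e : Fin n ≃ V) (U : Finset V) : U.card < n + 1 := by
  have h := Finset.card_le_univ U
  rw [Fintype.card_congr e.symm, Fintype.card_fin] at h
  omega

theorem treatVertex_ready (hn : 1 ≤ n) (hK : ∀ v, B.row v ≤ K) (hcol : ∀ v, B.col v ≤ n)
    (hw : 4 * n + 1 + (2 * n + 6) * numCodes n K < 2 ^ w) (hj : j ≤ n + 1) (ht : t < n)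
    (h : Ready B e K j j i (t + 1) (B.met e j (t + 1)) p l m) :
    Achieves w treatVertex (60 * numCodes n K) l m
      (fun l' m' => ∃ p', Ready B e K j j i t (B.met e j t) p' l' m') := by
  classical
  set v := e ⟨t, ht⟩ with hv
  have hK1 : 1 ≤ K := (B.one_le_row v).trans (hK v)
  have hKb := two_mul_le_numCodes (K := K) hn
  have h16 := sixteen_le_numCodes hn hK1
  have hexp : (2 * n + 6) * numCodes n K =
      2 * (n * numCodes n K) + 6 * numCodes n K := by ring
  obtain ⟨⟨s, hs, rfl⟩, htab, hin, hz⟩ := h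
  obtain ⟨s16, s17, s18, s19, s20, s21, s22, s23, s24, rfl⟩ := exists_of_length_nine hs
  have hvn := hcol v
  have hcompare : Achieves w compareColumn compareColumn.cost
      (regs n (n + 1) ((n + 1) ^ (2 * K)) (numCodes n K) (tableAddr n K j (B.met e j (t + 1)))
        (B.code (n + 1) K j (B.met e j (t + 1))) j i (t + 1) p
        [s16, s17, s18, s19, s20, s21, s22, s23, s24]) m
      (fun l' m' => (∃ f g x, l' = regs n (n + 1) ((n + 1) ^ (2 * K)) (numCodes n K)
        (tableAddr n K j (B.met e j (t + 1))) (B.code (n + 1) K j (B.met e j (t + 1))) j i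
        (t + 1) p [s16, s17, s18, 4 * (t + 1), f, g, B.col v - j + (j - B.col v), x, s24]) ∧
        m' = m) := by
    have e1 : m (4 * (t + 1) - 2) = B.col v := by
      rw [hin _ (by omega), encode_col B e ht]
    refine Achieves.of_vc ?_
    simp only [compareColumn, regs, block, VC, Op.eval, List.getD_cons_zero,
      List.getD_cons_succ, List.set_cons_zero, List.set_cons_succ, e1]
    exact ⟨by simp, by omega, by simp, by omega, by simp, by omega, by simp, by omega,
      by simp, by omega, by simp, by omega, by simp, by omega, by simp, by omega,
      ⟨_, _, _, rfl⟩, trivial⟩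
  refine (hcompare.seq
    (T₂ := (16 * K + 24 + (numCodes n K * (pushEntry.cost + 1) + 20) + 1) + 1) ?_).mono ?_
    fun _ _ => id
  · rintro _ _ ⟨⟨f, g, x, rfl⟩, rfl⟩
    refine Achieves.seq (R := fun l' m' => ∃ p',
      Ready B e K j j i (t + 1) (B.met e j t) p' l' m') (Achieves.cond ?_ ?_) ?_
    · intro hne
      rw [met_of_col_ne ht (by rintro h; simp [regs, hv, h] at hne)]
      exact (Achieves.of_vc (p := .skip) (Q := fun l' m' => ∃ p',
        Ready B e K j j i (t + 1) (B.met e j (t + 1)) p' l' m')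
        ⟨p, ⟨_, rfl, rfl⟩, htab, hin, hz⟩).mono (by simp only [Prog.cost]; omega) fun _ _ => id
    · intro heq
      -- a truncated difference vanishes in both directions only for equal columns
      have hvj : B.col v = j := by
        change B.col v - j + (j - B.col v) = 0 at heq
        omega
      have hmem : v ∉ B.met e j (t + 1) := notMem_met ht hvj
      rw [met_of_col_eq ht hvj, ← hv]
      refine (setVertexTransition_achieves hn hK hw hin ht).seq ?_
      rintro _ _ ⟨⟨s, hs, rfl⟩, rfl⟩
      refine (performTransition_ready (e := e) (j := j)
        ⟨⟨s, hs, rfl⟩, htab, hin, hz⟩ hK1 hK hw (by omega) (Nat.succ_pos _) le_rfl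
        (fun S hS => ?_) ?_ ?_ ?_).mono le_rfl fun l' m' hr => ⟨_, hr⟩
      · rw [transition_take_code hK (card_lt_succ e _) (fun h => hmem (hS h)) hvj]
        exact code_lt hK (card_lt_succ e _)
      · rw [Finset.card_insert_of_notMem hmem]
        omega
      · exact transition_take_code hK (card_lt_succ e _) hmem hvj
      · exact fun f f' hf hp => hf.pushes_vertex hK (card_lt_succ e _) hmem hvj
          (fun u hu => col_le_of_mem_met hu) hp
    · rintro l' m' ⟨p', ⟨s, hs, rfl⟩, htab', hin', hz'⟩
      refine Achieves.of_vc (p := .op .sub 10 10 1) ?_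
      simp only [regs, VC, Op.eval, List.getD_cons_zero, List.getD_cons_succ,
        List.set_cons_zero, List.set_cons_succ, Nat.add_sub_cancel]
      exact ⟨by simp, by omega, p', ⟨s, hs, rfl⟩, htab', hin', hz'⟩
  · simp only [compareColumn, pushEntry, block, Prog.cost]
    omega

/-- If the tables record the vertices of the columns before `j`, treating column `j` makes them
record the vertices of the columns up to `j`. The bound `j ≤ n + 1` keeps the addresses of all tables
below `2 ^ w`. -/
theorem treatColumn_ready (hn : 1 ≤ n) (hK : ∀ v, B.row v ≤ K) (hK1 : 1 ≤ K)
    (hcol : ∀ v, B.col v ≤ n)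
    (hw : 4 * n + 1 + (2 * n + 6) * numCodes n K < 2 ^ w) (hj : j ≤ n + 1) (hi : i ≤ n)
    (h : Ready B e K j j (i + 1) t (B.met e j n) p l m) :
    Achieves w treatColumn ((n + 1) * (61 * numCodes n K)) l m
      (fun l' m' => ∃ p', Ready B e K (j + 1) (j + 1) i 0 (B.met e (j + 1) n) p' l' m') := by
  have h16 := sixteen_le_numCodes hn hK1
  have hexp : (2 * n + 6) * numCodes n K =
      2 * (n * numCodes n K) + 6 * numCodes n K := by ring
  have hM : (n + 1) ^ (2 * K) ≤ numCodes n K := Nat.le_mul_of_pos_right _ (by positivity)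
  have hnM : n + 1 ≤ (n + 1) ^ (2 * K) := Nat.le_self_pow (by omega) _
  have hloop := Achieves.loop (w := w) (x := 10) (p := treatVertex) (T := 60 * numCodes n K)
    (fun t l m => t ≤ n ∧ ∃ p', Ready B e K j j (i + 1) t (B.met e j t) p' l m)
    (by
      rintro t l m ⟨-, p', ⟨s, -, rfl⟩, -⟩
      rfl)
    (by
      rintro t l m ⟨ht, p', h⟩
      refine (treatVertex_ready hn hK hcol hw hj (by omega) h).mono le_rfl ?_
      exact fun l' m' h' => ⟨by omega, h'⟩)
  obtain ⟨⟨s, hs, rfl⟩, htab, hin, hz⟩ := h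
  have hfirst : Achieves w (.op .add 10 2 0) 1 (regs n (n + 1) ((n + 1) ^ (2 * K))
      (numCodes n K) (tableAddr n K j (B.met e j n)) (B.code (n + 1) K j (B.met e j n)) j
      (i + 1) t p s) m (fun l' m' => Ready B e K j j (i + 1) n (B.met e j n) p l' m') := by
    refine Achieves.of_vc ?_
    simp only [regs, VC, Op.eval, List.getD_cons_zero, List.getD_cons_succ,
      List.set_cons_zero, List.set_cons_succ, Nat.add_zero]
    exact ⟨by simp, by omega, ⟨s, hs, rfl⟩, htab, hin, hz⟩
  refine (hfirst.seq (T₂ := n * (60 * numCodes n K + 1) + 1 +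
    (6 + ((numCodes n K * (pushEntry.cost + 1) + 20) + 3))) ?_).mono ?_ fun _ _ => id
  · intro l m h
    refine (hloop n l m ⟨le_rfl, p, h⟩).seq ?_
    rintro _ m ⟨-, p', ⟨s, hs, rfl⟩, htab, hin, hz⟩
    refine Achieves.seq (R := fun l' m' =>
      Ready B e K j j (i + 1) 0 (B.met e j 0) (Transition.shift (n + 1) K) l' m') ?_ ?_
    · refine (Achieves.of_vc (p := setShift) ?_)
      simp only [setShift, block, regs, VC, Op.eval, List.getD_cons_zero, List.getD_cons_succ,
        List.set_cons_zero, List.set_cons_succ, Nat.add_zero]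
      exact ⟨by simp, by omega, by simp, by omega, by simp, by omega, by simp, by omega,
        by simp, by omega, ⟨s, hs, rfl⟩, htab, hin, hz⟩
    · intro l m h
      have hle : ∀ u ∈ B.met e j 0, B.col u ≤ j := fun u hu => col_le_of_mem_met hu
      refine (performTransition_ready (j' := j + 1) (U' := B.met e j 0) h hK1 hK hw (by omega)
        one_pos (Nat.le_add_left _ _) (fun S hS => ?_) (by omega)
        (shift_take_code hK (card_lt_succ e _) hle)
        (fun f f' hf hp => hf.pushes_shift hK (card_lt_succ e _) hle hp)).seq ?_
      · rw [shift_take_code hK (card_lt_succ e _) fun u hu => hle u (hS hu)]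
        exact code_lt hK (card_lt_succ e _)
      · rintro l m ⟨⟨s, hs, rfl⟩, htab, hin, hz⟩
        refine Achieves.of_vc (p := block [.op .add 8 8 1, .op .sub 9 9 1]) ?_
        rw [← met_zero]
        simp only [block, regs, VC, Op.eval, List.getD_cons_zero, List.getD_cons_succ,
          List.set_cons_zero, List.set_cons_succ, Nat.add_sub_cancel]
        exact ⟨by simp, by omega, by simp, by omega, _, ⟨s, hs, rfl⟩, htab, hin, hz⟩
  · have : (n + 1) * (61 * numCodes n K) =
        60 * (n * numCodes n K) + n * numCodes n K + 61 * numCodes n K := by ring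
    have h2 : n * (60 * numCodes n K + 1) = 60 * (n * numCodes n K) + n := by ring
    have h3 : n ≤ n * numCodes n K := Nat.le_mul_of_pos_right _ (by omega)
    simp only [pushEntry, block, Prog.cost]
    omega

/-- The program works with the largest row `K` of a vertex, which is at most the number `k` of
rows. -/
theorem setUp_ready (hn : 1 ≤ n) {k : ℕ} (hk : ∀ v, B.row v ≤ k) (hk1 : 1 ≤ k)
    (hw : 4 * n + 1 + (2 * n + 6) * numCodes n k < 2 ^ w) :
    Achieves w setUp (n * 10 + 8 * k + 30) (List.replicate 25 0) (B.encode e)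
      (fun l' m' => ∃ K t p, K ≤ k ∧ 1 ≤ K ∧ (∀ v, B.row v ≤ K) ∧
        Ready B e K 1 1 (n + 1) t (B.met e 1 n) p l' m') := by
  have h16 := sixteen_le_numCodes hn hk1
  have hkb := two_mul_le_numCodes (K := k) hn
  have hexp : (2 * n + 6) * numCodes n k =
      2 * (n * numCodes n k) + 6 * numCodes n k := by ring
  have hnb : n ≤ n * numCodes n k := Nat.le_mul_of_pos_right _ (by omega)
  have hfirst : Achieves w (block [.const 1 1, .load 2 0, .op .add 3 2 1, .op .add 10 2 0]) 5
      (List.replicate 25 0) (B.encode e)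
      (fun l' m' => l' = [0, 1, n, n + 1, 0, 0, 0, 0, 0, 0, n, 0, 0, 0, 0, 0, 0, 0, 0,
        0, 0, 0, 0, 0, 0] ∧ m' = B.encode e) := by
    have e0 : B.encode e 0 = n := by simp [encode]
    refine Achieves.of_vc ?_
    simp only [List.replicate, block, VC, Op.eval, List.getD_cons_zero, List.getD_cons_succ,
      List.set_cons_zero, List.set_cons_succ, Nat.add_zero, e0]
    exact ⟨by simp, by omega, by simp, by omega, by simp, by omega, by simp, by omega, trivial,
      trivial⟩
  have hloop := Achieves.loop (w := w) (x := 10) (p := updateRows) (T := 9)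
    (fun t l m => t ≤ n ∧ m = B.encode e ∧ ∃ x y K,
      l = [0, 1, n, n + 1, 0, 0, 0, 0, 0, 0, t, 0, 0, 0, 0, 0, 0, 0, 0, x, y, K, 0, 0, 0] ∧
      K ≤ k ∧ ∀ v, t ≤ (e.symm v : ℕ) → B.row v ≤ K)
    (by
      rintro t l m ⟨-, -, x, y, K, rfl, -⟩
      rfl)
    (by
      rintro t l m ⟨ht, rfl, x, y, K, rfl, hKk, hK⟩
      have hrow := encode_row B e (t := t) (by omega)
      have hrk := hk (e ⟨t, by omega⟩)
      refine Achieves.of_vc (p := updateRows) ?_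
      simp only [updateRows, block, VC, Op.eval, List.getD_cons_zero, List.getD_cons_succ,
        List.set_cons_zero, List.set_cons_succ, Nat.add_sub_cancel, hrow]
      refine ⟨by simp, by omega, by simp, by omega, by simp, by omega, by simp, by omega,
        by simp, by omega, by simp, by omega, by simp, by omega, by simp, by omega,
        by omega, trivial, _, _, _, rfl, by omega, ?_⟩
      intro v hv
      obtain ⟨⟨y, hy⟩, rfl⟩ := e.surjective v
      rw [Equiv.symm_apply_apply] at hv
      rcases Nat.eq_or_lt_of_le hv with h | h
      · simp only at h
        subst h
        omega
      · have := hK (e ⟨y, hy⟩) (by rwa [Equiv.symm_apply_apply])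
        omega)
  refine (hfirst.seq (T₂ := n * (9 + 1) + 1 + (3 + (8 * k + 1 + 9))) ?_).mono (by omega)
    fun _ _ => id
  rintro _ _ ⟨rfl, rfl⟩
  refine (hloop n _ _ ⟨le_rfl, rfl, _, _, 0, rfl, Nat.zero_le _, fun v hv => ?_⟩).seq ?_
  · have := (e.symm v).isLt
    omega
  rintro _ _ ⟨-, rfl, x, y, K, rfl, hKk, hK⟩
  have hK' : ∀ v, B.row v ≤ K := fun v => hK v (Nat.zero_le _)
  have hK1 : 1 ≤ K := (B.one_le_row (e ⟨0, hn⟩)).trans (hK' _)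
  have hmono : numCodes n K ≤ numCodes n k :=
    Nat.mul_le_mul (Nat.pow_le_pow_right (by omega) (by omega))
      (Nat.pow_le_pow_right (by omega) (by omega))
  have hM : (n + 1) ^ (2 * K) ≤ numCodes n K := Nat.le_mul_of_pos_right _ (by positivity)
  have hdouble : Achieves w (block [.op .add 21 21 21, .op .add 4 1 0]) 3
      [0, 1, n, n + 1, 0, 0, 0, 0, 0, 0, 0, 0, 0, 0, 0, 0, 0, 0, 0, x, y, K, 0, 0, 0]
      (B.encode e)
      (fun l' m' => l' = [0, 1, n, n + 1, 1, 0, 0, 0, 0, 0, 0, 0, 0, 0, 0, 0, 0, 0, 0, x, y,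
        2 * K, 0, 0, 0] ∧ m' = B.encode e) := by
    refine Achieves.of_vc ?_
    simp only [block, VC, Op.eval, List.getD_cons_zero, List.getD_cons_succ,
      List.set_cons_zero, List.set_cons_succ, Nat.add_zero, ← two_mul]
    exact ⟨by simp, by omega, by simp, by omega, trivial, trivial⟩
  refine hdouble.seq ?_
  rintro _ _ ⟨rfl, rfl⟩
  have hpow : Achieves w (powLoop 4 3 21 1) (8 * k + 1)
      [0, 1, n, n + 1, 1, 0, 0, 0, 0, 0, 0, 0, 0, 0, 0, 0, 0, 0, 0, x, y, 2 * K, 0, 0, 0]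
      (B.encode e)
      (fun l' m' => l' = [0, 1, n, n + 1, 1 * (n + 1) ^ (2 * K), 0, 0, 0, 0, 0, 0, 0, 0, 0, 0,
        0, 0, 0, 0, x, y, 0, 0, 0, 0] ∧ m' = B.encode e) := by
    refine Achieves.mono (powLoop_achieves _ (by simp) (by simp) rfl
      (Nat.le_add_left _ _) (by simp) (by simp) (by simp) (by simp) (by simp) ?_ ?_) ?_ ?_
    · change 1 * (n + 1) ^ (2 * K) < 2 ^ w
      omega
    · change 2 * K < 2 ^ w
      omega
    · change 2 * K * 4 + 1 ≤ _
      omega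
    · rintro _ _ ⟨rfl, rfl⟩
      exact ⟨rfl, rfl⟩
  refine hpow.seq ?_
  rintro _ _ ⟨rfl, rfl⟩
  refine Achieves.of_vc ?_
  have hcode : B.code (n + 1) K 1 (B.met e 1 n) = 0 := by simp [met_one, code, colCode]
  have haddr : tableAddr n K 1 (B.met e 1 n) = 4 * n + 1 + numCodes n K := by
    simp [met_one, tableAddr]
  simp only [block, VC, Op.eval, List.getD_cons_zero, List.getD_cons_succ,
    List.set_cons_zero, List.set_cons_succ, Nat.add_zero, one_mul]
  rw [show (n + 1) ^ (2 * K) * (n + 1) ^ (2 * K) = numCodes n K from rfl]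
  refine ⟨by simp, by omega, by simp, by omega, by simp, by omega, by simp, by omega,
    by simp, by omega, by omega, by simp, by omega, by simp, by omega, K, 0, ⟨0, 0, 0, 0, 0⟩,
    hKk, hK1, hK', ⟨_, rfl, by rw [haddr, hcode]; rfl⟩, ?_, fun a ha => ?_, fun a ha => ?_⟩
  · rw [met_one (B := B) (e := e)] at haddr ⊢
    rw [haddr]
    refine isTable_empty _ (by simp) fun X hX => ?_
    rw [Function.update_of_ne (by omega)]
    exact encode_eq_zero B e (by omega)
  · exact Function.update_of_ne (by omega) _ _
  · have h16K := sixteen_le_numCodes hn hK1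
    rw [haddr] at ha
    rw [Function.update_of_ne (by omega)]
    exact encode_eq_zero B e (by omega)

theorem maxCutProgram_achieves (hn : 1 ≤ n) {k : ℕ} (hk : ∀ v, B.row v ≤ k) (hk1 : 1 ≤ k)
    (hcol : ∀ v, B.col v ≤ n) (hw : 4 * n + 1 + (2 * n + 6) * numCodes n k < 2 ^ w) :
    Achieves w maxCutProgram (100 * ((n + 1) * (n + 1) * numCodes n k))
      (List.replicate 25 0) (B.encode e)
      (fun l' _ => l'.getD 0 0 = maxCutSize B.graph) := by
  have h16 := sixteen_le_numCodes hn hk1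
  have hkb := two_mul_le_numCodes (K := k) hn
  refine ((setUp_ready (e := e) hn hk hk1 hw).seq
    (T₂ := (n + 1) * ((n + 1) * (61 * numCodes n k) + 1) + 1 + 3) ?_).mono ?_ fun _ _ => id
  · rintro l m ⟨K, t, p, hKk, hK1, hK, h⟩
    have hmono : numCodes n K ≤ numCodes n k :=
      Nat.mul_le_mul (Nat.pow_le_pow_right (by omega) (by omega))
        (Nat.pow_le_pow_right (by omega) (by omega))
    have hwK : 4 * n + 1 + (2 * n + 6) * numCodes n K < 2 ^ w :=
      lt_of_le_of_lt (Nat.add_le_add_left (Nat.mul_le_mul_left _ hmono) _) hw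
    have hloop := Achieves.loop (w := w) (x := 9) (p := treatColumn)
      (T := (n + 1) * (61 * numCodes n k))
      (fun i l m => i ≤ n + 1 ∧ ∃ t p,
        Ready B e K (n + 2 - i) (n + 2 - i) i t (B.met e (n + 2 - i) n) p l m)
      (by
        rintro i l m ⟨-, t, p, ⟨s, -, rfl⟩, -⟩
        rfl)
      (by
        rintro i l m ⟨hi, t, p, h⟩
        refine (treatColumn_ready hn hK hK1 hcol hwK (by omega) (by omega) h).mono
          (Nat.mul_le_mul_left _ (Nat.mul_le_mul_left _ hmono)) ?_
        rw [show n + 2 - (i + 1) + 1 = n + 2 - i by omega]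
        exact fun l' m' h' => ⟨by omega, 0, h'⟩)
    refine (hloop (n + 1) l m ⟨le_rfl, t, p, ?_⟩).seq ?_
    · rw [show n + 2 - (n + 1) = 1 by omega]
      exact h
    · rintro l m ⟨-, t, p, ⟨s, hs, rfl⟩, htab, hin, hz⟩
      rw [Nat.sub_zero] at *
      have huniv : B.met e (n + 2) n = Finset.univ := by
        ext v
        have := hcol v
        simp only [mem_met, Finset.mem_univ, iff_true]
        omega
      rw [huniv] at htab ⊢
      have hmax := htab.eq_maxCutSize (fun v => by have := hcol v; omega) (by omega)
      rw [Nat.add_zero] at hmax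
      have hcut : maxCutSize B.graph ≤ n * n := by
        refine Finset.sup_le fun S _ => ?_
        have := cutWithin_le (G := B.graph) S Finset.univ
        rwa [cutWithin_univ, Fintype.card_congr e.symm, Fintype.card_fin] at this
      have hsq := sq_le_numCodes (n := n) hk1
      have h1 : (n + 1) * (n + 1) = n * n + 2 * n + 1 := by ring
      have hexp : (2 * n + 6) * numCodes n k =
          2 * (n * numCodes n k) + 6 * numCodes n k := by ring
      refine Achieves.of_vc (p := block [.load 20 6, .op .sub 0 20 1]) ?_
      obtain ⟨s16, s17, s18, s19, s20, s21, s22, s23, s24, rfl⟩ := exists_of_length_nine hs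
      simp only [block, regs, VC, Op.eval, List.getD_cons_zero, List.getD_cons_succ,
        List.set_cons_zero, List.set_cons_succ, hmax, Nat.add_sub_cancel]
      exact ⟨by simp, by omega, by simp, by omega, trivial⟩
  · have h2 : (n + 1) * ((n + 1) * (61 * numCodes n k) + 1) =
        61 * ((n + 1) * (n + 1) * numCodes n k) + (n + 1) := by ring
    have h3 : (n + 1) * (n + 1) * numCodes n k =
        n * n * numCodes n k + 2 * (n * numCodes n k) + numCodes n k := by ring
    have h4 : n ≤ n * numCodes n k := Nat.le_mul_of_pos_right _ (by omega)
    omega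

end WordRAM

/-! ### The bound in terms of the numbers of vertices and rows -/

section Bound

/-- As `k ≤ n`, raising `n` to `n + 1` costs only a constant factor in `n ^ (4 * k)`. -/
theorem numCodes_le {n k : ℕ} (hn : 1 ≤ n) (hk : k ≤ n) :
    UBubbleStructure.numCodes n k ≤ 81 * n ^ (4 * k) := by
  have h : ((n + 1 : ℕ) : ℝ) ^ (4 * k) ≤ 81 * (n : ℝ) ^ (4 * k) := by
    have hn' : (0 : ℝ) < n := by exact_mod_cast hn
    have h1 : ((n + 1 : ℕ) : ℝ) ≤ n * Real.exp (1 / n) := by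
      have := Real.add_one_le_exp (1 / (n : ℝ))
      calc ((n + 1 : ℕ) : ℝ) = n * (1 / n + 1) := by
            push_cast
            field_simp
            ring
        _ ≤ _ := mul_le_mul_of_nonneg_left this hn'.le
    have h2 : Real.exp (1 / n) ^ (4 * k) ≤ 81 := by
      rw [← Real.exp_nat_mul]
      have h3 : ((4 * k : ℕ) : ℝ) * (1 / n) ≤ 4 := by
        rw [mul_one_div, div_le_iff₀ hn']
        exact_mod_cast Nat.mul_le_mul_left 4 hk
      calc Real.exp (((4 * k : ℕ) : ℝ) * (1 / n)) ≤ Real.exp 4 := Real.exp_le_exp.2 h3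
        _ = Real.exp 1 ^ 4 := by
            rw [← Real.exp_nat_mul]
            norm_num
        _ ≤ 3 ^ 4 := by
            have := Real.exp_one_lt_d9
            gcongr
            linarith
        _ = 81 := by norm_num
    calc ((n + 1 : ℕ) : ℝ) ^ (4 * k) ≤ (n * Real.exp (1 / n)) ^ (4 * k) := by gcongr
      _ = Real.exp (1 / n) ^ (4 * k) * (n : ℝ) ^ (4 * k) := by rw [mul_pow, mul_comm]
      _ ≤ _ := by gcongr
  have h' : (n + 1) ^ (4 * k) ≤ 81 * n ^ (4 * k) := by exact_mod_cast h
  rw [UBubbleStructure.numCodes, ← pow_add]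
  convert h' using 2
  ring

end Bound

namespace UBubbleStructure

variable {V : Type*} {B : UBubbleStructure V}

theorem row_le_numRows (v : V) : B.row v ≤ B.numRows :=
  (B.row_le v).trans (Finset.le_sup (f := B.len)
    (Finset.mem_Icc.2 ⟨B.one_le_col v, B.col_le v⟩))

theorem IsModel.numRows_le [Fintype V] [Nonempty V] {G : SimpleGraph V} (h : B.IsModel G) :
    B.numRows ≤ Fintype.card V := by
  choose! c hc using h.row_nonempty
  choose! f hf using hc
  have := Finset.card_le_card_of_injOn (s := Finset.Icc 1 B.numRows) (t := Finset.univ) f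
    (fun _ _ => Finset.mem_coe.2 (Finset.mem_univ _)) (by
      intro x hx y hy hxy
      rw [Finset.coe_Icc, Set.mem_Icc] at hx hy
      rw [← (hf x hx.1 hx.2).1, ← (hf y hy.1 hy.2).1, hxy])
  simpa using this

theorem IsModel.numCols_le [Fintype V] [Nonempty V] {G : SimpleGraph V} (h : B.IsModel G) :
    B.numCols ≤ Fintype.card V := by
  choose! r hr using h.col_nonempty
  choose! f hf using hr
  have := Finset.card_le_card_of_injOn (s := Finset.Icc 1 B.numCols) (t := Finset.univ) f
    (fun _ _ => Finset.mem_coe.2 (Finset.mem_univ _)) (by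
      intro x hx y hy hxy
      rw [Finset.coe_Icc, Set.mem_Icc] at hx hy
      rw [← (hf x hx.1 hx.2).2, ← (hf y hy.1 hy.2).2, hxy])
  simpa using this

end UBubbleStructure

theorem corollary4 :
    ∃ (P : WordRAM.Prog) (c C : ℕ),
      ∀ (k n : ℕ) (V : Type*) [Fintype V] [Nonempty V] (G : SimpleGraph V)
        (B : UBubbleStructure V), B.IsModel G → B.numRows = k →
        ∀ (e : Fin n ≃ V) (w : ℕ), C * n ^ (4 * k + c) ≤ 2 ^ w →
          ∃ (t : ℕ) (s : WordRAM.State),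
            WordRAM.Runs w P (WordRAM.initState (B.encode e)) t s ∧
            t ≤ C * n ^ (4 * k + c) ∧
            s.reg 0 = maxCutSize G := by
  -- the time is at most `100 * (n + 1) ^ 2 * (81 * n ^ (4 * k))`, and `n + 1 ≤ 2 * n`
  refine ⟨WordRAM.maxCutProgram, 2, 32400, ?_⟩
  rintro k n V _ _ G B hB rfl e w hw
  obtain ⟨v₀⟩ := id ‹Nonempty V›
  have hcard : Fintype.card V = n := by rw [Fintype.card_congr e.symm, Fintype.card_fin]
  have hn : 1 ≤ n := (Nat.zero_le _).trans_lt (e.symm v₀).isLt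
  have hk := hcard ▸ hB.numRows_le
  have hcol : ∀ v, B.col v ≤ n := fun v => (B.col_le v).trans (hcard ▸ hB.numCols_le)
  have hb := numCodes_le hn hk
  have hb1 : 1 ≤ UBubbleStructure.numCodes n B.numRows :=
    Nat.mul_pos (by positivity) (by positivity)
  set b := UBubbleStructure.numCodes n B.numRows
  have htime : 100 * ((n + 1) * (n + 1) * b) ≤ 32400 * n ^ (4 * B.numRows + 2) := by
    calc 100 * ((n + 1) * (n + 1) * b)
        ≤ 100 * ((2 * n) * (2 * n) * (81 * n ^ (4 * B.numRows))) := by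
          gcongr <;> omega
      _ = 32400 * n ^ (4 * B.numRows + 2) := by ring
  have hword : 4 * n + 1 + (2 * n + 6) * b < 2 ^ w := by
    have h1 : (n + 1) * (n + 1) * b = n * n * b + 2 * (n * b) + b := by ring
    have h2 : (2 * n + 6) * b = 2 * (n * b) + 6 * b := by ring
    have h3 : n ≤ n * b := Nat.le_mul_of_pos_right _ hb1
    omega
  obtain ⟨t, l, m, hr, ht, hl⟩ := WordRAM.maxCutProgram_achieves (e := e) hn
    UBubbleStructure.row_le_numRows ((B.one_le_row v₀).trans (UBubbleStructure.row_le_numRows v₀))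
    hcol hword
  have hinit : WordRAM.listState (List.replicate 25 0) (B.encode e) =
      WordRAM.initState (B.encode e) := by
    unfold WordRAM.listState WordRAM.initState
    congr 1
    funext i
    rw [List.getD_eq_getElem?_getD, List.getElem?_replicate]
    split_ifs <;> rfl
  rw [hinit] at hr
  obtain ⟨φ⟩ := hB.iso
  exact ⟨t, _, hr, ht.trans htime, hl.trans (maxCutSize_eq_of_iso φ).symm⟩
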